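/- **Setting.** A seller has $\mathrm{copies}(a)\in\mathbb N$ copies of each item $a$. There are $n$ agents; agent $i$ is interested in a known finite collection $\mathcal B_i$ of bundles (finite sets of items), each of size at most $m$, and has one private value $v_i\ge 0$ for getting any one of them. The values are independent, $v_i\sim F_i$, where $F_i$ is an arbitrary distribution on $[0,\infty)$ with finite mean (atoms and irregular distributions are allowed). Let $\mathcal J$ be the family of sets $S$ of agents such that every $i\in S$ can be given a bundle from $\mathcal B_i$ with no item $a$ used more than $\mathrm{copies}(a)$ times. **Revenue curves.** For $q\in(0,1]$ let $F_i^{-1}(1-q)$ be the largest price $p$ with $\Pr[v_i\ge p]\ge q$, let $R_i(q)=q\,F_i^{-1}(1-q)$, $R_i(0)=0$, and let $\bar R_i$ be the concave hull of $R_i$ on $[0,1]$. The ironed virtual value of $v$ is the right derivative of $\bar R_i$ at $1-F_i(v)$ ($-\infty$ if $F_i(v)=0$). $F_i$ is regular if it has a density $f_i$ for which the virtual value $v-\frac{1-F_i(v)}{f_i(v)}$ (read as $-\infty$ where $f_i(v)=0$ and $F_i(v)<1$) is nondecreasing on $[0,\infty)$. **Myerson's mechanism** serves a set in $\mathcal J$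 that maximizes the sum of the ironed virtual values of its members (for a regular $F_i$, the virtual value may be used instead), ties being broken by an arbitrary measurable rule that depends only on the vector of these (ironed) virtual values; a served agent pays the infimum of the nonnegative values at which it would still be served, the other agents pay $0$. Let $q_i$ be the probability that it serves agent $i$. **The sequential posted price mechanism (SPM).** If $F_i$ is regular put $a_i=b_i=q_i$; otherwise let $a_i\le q_i\le b_i$ be the nearest points on either side of $q_i$ at which $R_i=\bar R_i$ (so $a_i=b_i=q_i$ if $R_i(q_i)=\bar R_i(q_i)$). Choose $s_i=b_i$ with probability $x_i$ and $s_i=a_i$ with probability $1-x_i$, independently over $i$, where $x_ib_i+(1-x_i)a_i=q_i$; then post the price $F_i^{-1}(1-s_i)$ with probability $s_i/\Pr[v_i\ge F_i^{-1}(1-s_i)]$, and make no offer otherwise (or if $s_i=0$). Thus for regular $F_i$ and $q_i>0$ the price is just $F_i^{-1}(1-q_i)$. Agents are approached in an order of decreasing $p_i=\big(x_iR_i(b_i)+(1-x_i)R_i(a_i)\big)/q_i$ ($p_i=0$ if $q_i=0$), with ties broken arbitrarily. When agent $i$'s turn comes and $A$ is the set of agents served so far, the offer is made iff $A\cup\{i\}\in\mathcal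 J$, and the agent accepts iff the price is at most $v_i$. **Theorem.** The revenue of Myerson's mechanism is integrable, and the SPM $(m+1)$-approximates it: $$\mathbb E[\text{revenue of Myerson's mechanism}]\le (m+1)\,\mathbb E[\text{revenue of the SPM}].$$ The same inequality holds for the variant of the SPM that gives each agent it serves, at once, an arbitrary desired bundle that is still in stock (chosen by any rule that is a function of the agent and of the bundles allocated so far), and that skips an agent iff none of its desired bundles is still in stock. -/

import Mathlib

open MeasureTheory Set

noncomputable section

/-! ### One-agent quantities

A value distribution is a probability measure `D` on `ℝ` carried by `[0, ∞)`. -/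

/-- The inverse demand `F⁻¹(1 - q)`: the largest price accepted with probability at least `q`. -/
def priceAt (D : Measure ℝ) (q : ℝ) : ℝ :=
  sSup {p : ℝ | q ≤ D.real (Ici p)}

/-- The revenue curve `R(q) = q · F⁻¹(1 - q)`. -/
def revenueCurve (D : Measure ℝ) (q : ℝ) : ℝ :=
  q * priceAt D q

/-- The ironed revenue curve: the concave hull of `R` on `[0, 1]`, as the pointwise infimum of the
affine functions that lie above `R` on `[0, 1]`. -/
def ironedCurve (D : Measure ℝ) (q : ℝ) : ℝ :=
  sInf {y : ℝ | ∃ c d : ℝ, (∀ t ∈ Icc (0 : ℝ) 1, revenueCurve D t ≤ c + d * t) ∧ y = c + d * q}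

/-- The virtual value `v - (1 - F v) / f v` for the density `f`; it is `-∞` where `f v = 0` and
`F v < 1`. -/
def virtualValue (D : Measure ℝ) (f : ℝ → ℝ) (v : ℝ) : EReal :=
  open Classical in
  if f v = 0 ∧ D.real (Iic v) < 1 then ⊥
  else ((v - (1 - D.real (Iic v)) / f v : ℝ) : EReal)

/-- `f` is a density of `D` whose virtual value is nondecreasing. -/
def IsRegularDensity (D : Measure ℝ) (f : ℝ → ℝ) : Prop :=
  Measurable f ∧ (∀ v, 0 ≤ f v) ∧ D = volume.withDensity (fun v => ENNReal.ofReal (f v)) ∧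
    MonotoneOn (virtualValue D f) (Ici 0)

/-- Regular distributions. -/
def IsRegularDist (D : Measure ℝ) : Prop :=
  ∃ f : ℝ → ℝ, IsRegularDensity D f

/-- The ironed virtual value of `v`: the right derivative of the (concave) ironed revenue curve at
the quantile `1 - F v`, written as the supremum of the slopes to the right of that quantile.
It is `-∞` if `F v = 0`. -/
def ironedVirtualValue (D : Measure ℝ) (v : ℝ) : EReal :=
  ⨆ t ∈ Ioc (D.real (Ioi v)) 1,
    (((ironedCurve D t - ironedCurve D (D.real (Ioi v))) / (t - D.real (Ioi v)) : ℝ) : EReal)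

/-- The function through which Myerson's mechanism evaluates an agent: the virtual value if the
distribution is regular, or the ironed virtual value, which makes sense for all distributions. -/
def IsMyersonValue (D : Measure ℝ) (ψ : ℝ → EReal) : Prop :=
  (∃ f : ℝ → ℝ, IsRegularDensity D f ∧ ψ = virtualValue D f) ∨ ψ = ironedVirtualValue D

/-! ### Myerson's mechanism -/

/-- `t` selects, for each vector `w` of (ironed) virtual values, a feasible set of maximum virtual
surplus. Ties are broken arbitrarily but consistently: the choice depends on `w` only. -/
def IsSurplusMaximizer {n : ℕ} (J : Set (Finset (Fin n)))
    (t : (Fin n → EReal) → Finset (Fin n)) : Prop :=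
  (∀ w, t w ∈ J ∧ ∀ S ∈ J, ∑ i ∈ S, w i ≤ ∑ i ∈ t w, w i) ∧
    ∀ S, MeasurableSet {w | t w = S}

/-- The set of agents that Myerson's mechanism serves at the value profile `v`. -/
def myersonAlloc {n : ℕ} (ψ : Fin n → ℝ → EReal) (t : (Fin n → EReal) → Finset (Fin n))
    (v : Fin n → ℝ) : Finset (Fin n) :=
  t (fun i => ψ i (v i))

/-- The truthful payments for the allocation rule `A`: a served agent pays the smallest value at
which it would still be served, the other agents pay nothing. -/
def truthfulPayment {n : ℕ} (A : (Fin n → ℝ) → Finset (Fin n)) (v : Fin n → ℝ) (i : Fin n) : ℝ :=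
  open Classical in
  if i ∈ A v then sInf {z : ℝ | 0 ≤ z ∧ i ∈ A (Function.update v i z)} else 0

/-- The probability with which the allocation rule `A` serves agent `i`. -/
def serviceProb {n : ℕ} (D : Fin n → Measure ℝ) (A : (Fin n → ℝ) → Finset (Fin n))
    (i : Fin n) : ℝ :=
  (Measure.pi D).real {v | i ∈ A v}

/-- The expected revenue of the allocation rule `A` with its truthful payments. -/
def truthfulRevenue {n : ℕ} (D : Fin n → Measure ℝ) (A : (Fin n → ℝ) → Finset (Fin n)) : ℝ :=
  ∫ v, ∑ i, truthfulPayment A v i ∂(Measure.pi D)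

/-! ### The price lottery of the sequential posted price mechanism

For a sale probability `q`, let `[a, b]` be the ironing interval around `q`. The mechanism posts
the price for sale probability `b` or the one for sale probability `a`, mixed so that the overall
sale probability is `q`. If `D` is regular, or `R` is not ironed at `q`, then `a = b = q`, and
the price is `F⁻¹(1 - q)`. If `D` has an atom at a price `p = F⁻¹(1 - s)`, then `p` is only offered
with probability `s / P(V ≥ p)`, so that it is accepted with probability exactly `s`. -/

/-- The left end `a` of the ironing interval around `q`. -/
def lowerQuantile (D : Measure ℝ) (q : ℝ) : ℝ :=
  open Classical in
  if IsRegularDist D then q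
  else sSup {s : ℝ | s ∈ Icc 0 q ∧ revenueCurve D s = ironedCurve D s}

/-- The right end `b` of the ironing interval around `q`. -/
def upperQuantile (D : Measure ℝ) (q : ℝ) : ℝ :=
  open Classical in
  if IsRegularDist D then q
  else sInf {s : ℝ | s ∈ Icc q 1 ∧ revenueCurve D s = ironedCurve D s}

/-- The weight `x` with `x * b + (1 - x) * a = q`; it is `0` if `a = b`. -/
def mixWeight (D : Measure ℝ) (q : ℝ) : ℝ :=
  (q - lowerQuantile D q) / (upperQuantile D q - lowerQuantile D q)

/-- The three possible offers: the low price, the high price, no offer. -/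
def offer (D : Measure ℝ) (q : ℝ) : Fin 3 → Option ℝ :=
  ![some (priceAt D (upperQuantile D q)), some (priceAt D (lowerQuantile D q)), none]

/-- The probability of posting the price `F⁻¹(1 - s)`, once it has been chosen. -/
def postProb (D : Measure ℝ) (s : ℝ) : ℝ :=
  s / D.real (Ici (priceAt D s))

/-- The probabilities of the three offers. -/
def offerProb (D : Measure ℝ) (q : ℝ) : Fin 3 → ℝ :=
  ![mixWeight D q * postProb D (upperQuantile D q),
    (1 - mixWeight D q) * postProb D (lowerQuantile D q),
    1 - mixWeight D q * postProb D (upperQuantile D q)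
      - (1 - mixWeight D q) * postProb D (lowerQuantile D q)]

/-- The price by which the agents are ordered: the expected price conditioned on a sale. It equals
`F⁻¹(1 - q)` if `a = b = q > 0`. -/
def effectivePrice (D : Measure ℝ) (q : ℝ) : ℝ :=
  (mixWeight D q * (upperQuantile D q * priceAt D (upperQuantile D q))
    + (1 - mixWeight D q) * (lowerQuantile D q * priceAt D (lowerQuantile D q))) / q

/-! ### Running sequential posted prices -/

/-- An agent of value `x` accepts an offer iff there is one and its price is at most `x`. -/
def Accepts (o : Option ℝ) (x : ℝ) : Prop :=
  ∃ p, o = some p ∧ p ≤ x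

/-- The set served if the offers `o` are made in the order `σ`, an agent being skipped if it cannot
be served together with those already served. -/
def spmServed {n : ℕ} (J : Set (Finset (Fin n))) (σ : Equiv.Perm (Fin n)) (o : Fin n → Option ℝ)
    (v : Fin n → ℝ) : Finset (Fin n) :=
  open Classical in
  (List.finRange n).foldl
    (fun A k => if insert (σ k) A ∈ J ∧ Accepts (o (σ k)) (v (σ k)) then insert (σ k) A else A) ∅

/-- The expectation, over independent values and independent price lotteries for the sale
probabilities `q`, of the sum of the prices offered to the agents served. -/
def expectedSales {n : ℕ} (D : Fin n → Measure ℝ) (q : Fin n → ℝ)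
    (served : (Fin n → Option ℝ) → (Fin n → ℝ) → Finset (Fin n)) : ℝ :=
  ∑ c : Fin n → Fin 3, (∏ i, offerProb (D i) (q i) (c i)) *
    ∫ v, ∑ i ∈ served (fun i => offer (D i) (q i) (c i)) v, (offer (D i) (q i) (c i)).getD 0
      ∂(Measure.pi D)

/-! ### Combinatorial auctions with known bundles -/

/-- A set of agents is feasible if every agent in it can be given one of its desired bundles so that
no item is used more often than there are copies of it. -/
def bundleFeasible {n : ℕ} {Item : Type*} [DecidableEq Item] (copies : Item → ℕ)
    (desired : Fin n → Finset (Finset Item)) : Set (Finset (Fin n)) :=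
  {S | ∃ b : Fin n → Finset Item, (∀ i ∈ S, b i ∈ desired i) ∧
    ∀ a, (S.filter (fun i => a ∈ b i)).card ≤ copies a}

/-- After the bundles `alloc` have been handed out, `b` is a desired bundle of agent `i` all of whose
items are still in stock. -/
def IsAvailable {n : ℕ} {Item : Type*} [DecidableEq Item] (copies : Item → ℕ)
    (desired : Fin n → Finset (Finset Item)) (alloc : Fin n → Option (Finset Item))
    (i : Fin n) (b : Finset Item) : Prop :=
  b ∈ desired i ∧ ∀ a ∈ b, {j | ∃ c, alloc j = some c ∧ a ∈ c}.ncard < copies a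

/-- A rule that allocates an arbitrary available desired bundle. -/
def IsBundleRule {n : ℕ} {Item : Type*} [DecidableEq Item] (copies : Item → ℕ)
    (desired : Fin n → Finset (Finset Item))
    (β : (Fin n → Option (Finset Item)) → Fin n → Finset Item) : Prop :=
  ∀ alloc i, (∃ b, IsAvailable copies desired alloc i b) →
    IsAvailable copies desired alloc i (β alloc i)

/-- The set served if, in addition, every agent served is at once given the bundle chosen by `β`,
and an agent is skipped if none of its desired bundles is available any more. -/
def bundleServed {n : ℕ} {Item : Type*} [DecidableEq Item] (copies : Item → ℕ)
    (desired : Fin n → Finset (Finset Item))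
    (β : (Fin n → Option (Finset Item)) → Fin n → Finset Item) (σ : Equiv.Perm (Fin n))
    (o : Fin n → Option ℝ) (v : Fin n → ℝ) : Finset (Fin n) :=
  open Classical in
  Finset.univ.filter fun i =>
    ((List.finRange n).foldl
      (fun alloc k =>
        if (∃ b, IsAvailable copies desired alloc (σ k) b) ∧ Accepts (o (σ k)) (v (σ k)) then
          Function.update alloc (σ k) (some (β alloc (σ k)))
        else alloc)
      (fun _ => none) i).isSome

end

noncomputable section

/-! ### Prices and revenue curves -/

/-! Both revenues are compared with `∑ pᵢ qᵢ`, where `pᵢ` is the effective price of agent `i` at its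
service probability `qᵢ`.

Upper bound. Fix the values of all agents but `i`. A served agent pays a threshold `T` that does not
depend on its own value, and almost surely it is served only at values at least `T`. If `Q` is the
conditional probability of service, then `T ≤ F⁻¹(1 - Q)`, so the expected payment `Q * T` is at
most `R(Q)`, hence at most `c + d * Q` for every affine majorant of `R`. Averaging over the other
agents replaces `Q` by `qᵢ`, and the infimum over majorants gives `ironedCurve (D i) (q i)`
(`integral_truthfulPayment_le`). The virtual value formula for revenue is not needed: Myerson's rule
enters only through feasibility, measurability and monotonicity, the last making the payments
measurable. The price lottery attains the hull: since `R` is upper semicontinuous, an optimal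
majorant touches it on both sides of `q`, and mixing the two nearest contact points yields at least
`ironedCurve D q` (`exists_contact_interval`, `ironing_interval`). For a regular distribution `R` is
its own hull (`IsRegularDensity.ironedCurve_le_revenueCurve`).

Lower bound. Whether an agent is still open at its turn depends on earlier agents only, so the
posted prices earn `∑ P(open) pᵢ qᵢ`. The missing part, `∑ pᵢ qᵢ` over blocked agents, is at most
`m` times the effective prices of the served agents, in every realisation
(`GreedyProcess.sum_blocked_le`). Indeed, as prices decrease, Abel summation reduces this to
counting in prefixes of the order. There `qᵢ` is the chance that a random feasible set contains `i`,
and a feasible set contains at most `m` blocked agents per served one: each blocked agent wants an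
exhausted item, and each served agent helps to exhaust at most `m` items
(`card_le_mul_card_of_exhausted`). By independence the expected effective prices of the served
agents equal the sales revenue, so `∑ pᵢ qᵢ` is at most `m + 1` times that revenue. -/

theorem sub_mul_measureReal_Ici_le (D : Measure ℝ) [IsProbabilityMeasure D]
    (hint : Integrable (fun x : ℝ => x) D) (p M : ℝ) :
    (p - M) * D.real (Ici p) ≤ ∫ x, max (x - M) 0 ∂D := by
  have hi : Integrable (fun x : ℝ => max (x - M) 0) D :=
    (hint.sub (integrable_const M)).pos_part
  have h0 : 0 ≤ ∫ x, max (x - M) 0 ∂D := integral_nonneg fun x => le_max_right _ _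
  rcases le_or_gt p M with h | h
  · exact (mul_nonpos_of_nonpos_of_nonneg (by linarith) measureReal_nonneg).trans h0
  · refine le_trans ?_ (mul_meas_ge_le_integral_of_nonneg
      (ae_of_all _ fun x => le_max_right _ _) hi (p - M))
    refine mul_le_mul_of_nonneg_left (measureReal_mono ?_) (by linarith)
    intro x hx
    simp only [mem_Ici] at hx
    simp only [mem_ofPred_eq]
    exact le_max_of_le_left (by linarith)

theorem measureReal_Ici_eq_one {D : Measure ℝ} [IsProbabilityMeasure D] (hpos : D (Iio 0) = 0)
    {p : ℝ} (hp : p ≤ 0) : D.real (Ici p) = 1 := by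
  have h : D.real (Iio p) = 0 := by
    rw [measureReal_def, measure_mono_null (Iio_subset_Iio hp) hpos]; simp
  have := probReal_compl_eq_one_sub (μ := D) (measurableSet_Iio (a := p))
  rwa [compl_Iio, h, sub_zero] at this

theorem bddAbove_priceSet (D : Measure ℝ) [IsProbabilityMeasure D]
    (hint : Integrable (fun x : ℝ => x) D) {q : ℝ} (hq : 0 < q) :
    BddAbove {p : ℝ | q ≤ D.real (Ici p)} := by
  refine ⟨(∫ x, max (x - 0) 0 ∂D) / q, fun p hp => ?_⟩
  have h := sub_mul_measureReal_Ici_le D hint p 0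
  have h0 : 0 ≤ ∫ x, max (x - 0) 0 ∂D := integral_nonneg fun x => le_max_right _ _
  simp only [mem_ofPred_eq] at hp
  rw [le_div_iff₀ hq]
  rcases le_or_gt p 0 with h' | h'
  · nlinarith
  · nlinarith

theorem le_priceAt (D : Measure ℝ) [IsProbabilityMeasure D]
    (hint : Integrable (fun x : ℝ => x) D) {q p : ℝ} (hq : 0 < q) (h : q ≤ D.real (Ici p)) :
    p ≤ priceAt D q :=
  le_csSup (bddAbove_priceSet D hint hq) h

/-- Every price qualifies, and `sSup` of an unbounded set of reals is `0` by convention. -/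
theorem priceAt_zero (D : Measure ℝ) : priceAt D 0 = 0 := by
  have : {p : ℝ | 0 ≤ D.real (Ici p)} = univ := by ext; simp
  rw [priceAt, this, Real.sSup_univ]

theorem priceAt_nonneg {D : Measure ℝ} [IsProbabilityMeasure D] (hpos : D (Iio 0) = 0)
    (hint : Integrable (fun x : ℝ => x) D) {q : ℝ} (hq : q ∈ Icc (0 : ℝ) 1) :
    0 ≤ priceAt D q := by
  rcases hq.1.eq_or_lt with h | h
  · rw [← h, priceAt_zero]
  · exact le_priceAt D hint h (by rw [measureReal_Ici_eq_one hpos le_rfl]; exact hq.2)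

/-- The supremum defining the price is attained, by continuity of the measure along the half lines
decreasing to `Ici P`. -/
theorem le_measureReal_Ici_priceAt {D : Measure ℝ} [IsProbabilityMeasure D]
    (hpos : D (Iio 0) = 0) {q : ℝ} (hq : q ∈ Icc (0 : ℝ) 1) :
    q ≤ D.real (Ici (priceAt D q)) := by
  have hne : {p : ℝ | q ≤ D.real (Ici p)}.Nonempty :=
    ⟨0, by simp only [mem_ofPred_eq]; rw [measureReal_Ici_eq_one hpos le_rfl]; exact hq.2⟩
  set P := priceAt D q with hP
  have hanti : Antitone fun k : ℕ => Ici (P - 1 / ((k : ℝ) + 1)) := fun k l hkl =>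
    Ici_subset_Ici.2 (sub_le_sub_left (Nat.one_div_le_one_div hkl) _)
  have hlim := tendsto_measure_iInter_atTop (μ := D)
    (s := fun k : ℕ => Ici (P - 1 / ((k : ℝ) + 1)))
    (fun k : ℕ => (measurableSet_Ici (a := P - 1 / ((k : ℝ) + 1))).nullMeasurableSet)
    hanti ⟨0, measure_ne_top _ _⟩
  have hInter : ⋂ k : ℕ, Ici (P - 1 / ((k : ℝ) + 1)) = Ici P := by
    ext x
    simp only [mem_iInter, mem_Ici]
    refine ⟨fun h => ?_, fun h k => ?_⟩
    · by_contra hx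
      obtain ⟨k, hk⟩ := exists_nat_one_div_lt (sub_pos.2 (not_le.1 hx))
      have := h k
      linarith
    · have : (0 : ℝ) < 1 / ((k : ℝ) + 1) := by positivity
      linarith
  rw [hInter] at hlim
  have hlim' := (ENNReal.tendsto_toReal (measure_ne_top D (Ici P))).comp hlim
  refine ge_of_tendsto hlim' (Filter.Eventually.of_forall fun k => ?_)
  have hk : (0 : ℝ) < 1 / ((k : ℝ) + 1) := by positivity
  obtain ⟨p, hp, hlt⟩ := exists_lt_of_lt_csSup hne (show P - 1 / ((k : ℝ) + 1) < sSup _ by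
    rw [← priceAt, ← hP]; linarith)
  exact le_trans hp (measureReal_mono (Ici_subset_Ici.2 hlt.le))

theorem revenueCurve_zero (D : Measure ℝ) : revenueCurve D 0 = 0 := zero_mul _

theorem revenueCurve_nonneg {D : Measure ℝ} [IsProbabilityMeasure D] (hpos : D (Iio 0) = 0)
    (hint : Integrable (fun x : ℝ => x) D) {q : ℝ} (hq : q ∈ Icc (0 : ℝ) 1) :
    0 ≤ revenueCurve D q :=
  mul_nonneg hq.1 (priceAt_nonneg hpos hint hq)

/-- Markov's inequality for `(V - M)⁺`. This supplies an affine majorant of every slope `M`, whose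
intercept tends to `0` as `M` grows. -/
theorem revenueCurve_le {D : Measure ℝ} [IsProbabilityMeasure D] (hpos : D (Iio 0) = 0)
    (hint : Integrable (fun x : ℝ => x) D) {M q : ℝ} (hq : q ∈ Icc (0 : ℝ) 1) :
    revenueCurve D q ≤ q * M + ∫ x, max (x - M) 0 ∂D := by
  have h := sub_mul_measureReal_Ici_le D hint (priceAt D q) M
  have h0 : 0 ≤ ∫ x, max (x - M) 0 ∂D := integral_nonneg fun x => le_max_right _ _
  have h1 := le_measureReal_Ici_priceAt hpos hq
  have hq0 := hq.1
  rw [revenueCurve]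
  rcases le_total (priceAt D q) M with h' | h' <;> nlinarith

theorem tendsto_integral_max_sub (D : Measure ℝ) [IsProbabilityMeasure D]
    (hint : Integrable (fun x : ℝ => x) D) :
    Filter.Tendsto (fun k : ℕ => ∫ x, max (x - k) 0 ∂D) Filter.atTop (nhds 0) := by
  have h0 : ∫ _, (0 : ℝ) ∂D = 0 := by simp
  rw [show nhds (0 : ℝ) = nhds (∫ _, (0 : ℝ) ∂D) by rw [h0]]
  refine tendsto_integral_of_dominated_convergence (F := fun (k : ℕ) (x : ℝ) => max (x - k) 0)
    (f := fun _ => 0) (fun x => |x|)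
    (fun k => ((hint.sub (integrable_const (k : ℝ))).pos_part).aestronglyMeasurable)
    hint.abs (fun k => ae_of_all _ fun x => ?_) (ae_of_all _ fun x => ?_)
  · rw [Real.norm_of_nonneg (le_max_right _ _)]
    refine max_le ?_ (abs_nonneg x)
    have := le_abs_self x
    have : (0 : ℝ) ≤ k := k.cast_nonneg
    linarith
  · refine tendsto_const_nhds.congr' ?_
    obtain ⟨N, hN⟩ := exists_nat_ge x
    filter_upwards [Filter.eventually_ge_atTop N] with k hk
    have : (N : ℝ) ≤ k := by exact_mod_cast hk
    rw [max_eq_right]; linarith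

/-- At `0` the majorants of small intercept squeeze the curve. At `s > 0`, a price `p` slightly
above `priceAt D s` sells with probability below `s`, hence below every nearby `t`, which forces
`priceAt D t ≤ p`. -/
theorem upperSemicontinuousOn_revenueCurve {D : Measure ℝ} [IsProbabilityMeasure D]
    (hpos : D (Iio 0) = 0) (hint : Integrable (fun x : ℝ => x) D) :
    UpperSemicontinuousOn (revenueCurve D) (Icc 0 1) := by
  intro s hs y hy
  rcases hs.1.eq_or_lt with h | h
  · subst h
    rw [revenueCurve_zero] at hy
    obtain ⟨k, hk⟩ := ((tendsto_integral_max_sub D hint).eventually (gt_mem_nhds hy)).exists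
    have hc : Filter.Tendsto (fun t : ℝ => t * k + ∫ x, max (x - k) 0 ∂D)
        (nhdsWithin 0 (Icc 0 1)) (nhds (0 * k + ∫ x, max (x - k) 0 ∂D)) :=
      (Continuous.tendsto (by fun_prop) 0).mono_left nhdsWithin_le_nhds
    filter_upwards [hc.eventually (gt_mem_nhds (by simpa using hk)), self_mem_nhdsWithin]
      with t ht htI
    exact (revenueCurve_le hpos hint htI).trans_lt ht
  · have h1 : priceAt D s < y / s := by
      rw [lt_div_iff₀ h, mul_comm]; exact hy
    obtain ⟨p, hp1, hp2⟩ := exists_between h1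
    have hp0 : D.real (Ici p) < s := by
      by_contra hcon
      exact absurd (le_priceAt D hint h (not_lt.1 hcon)) (not_le.2 hp1)
    have hsp : s * p < y := by rw [lt_div_iff₀ h, mul_comm] at hp2; exact hp2
    have hc : Filter.Tendsto (fun t : ℝ => t * p) (nhds s) (nhds (s * p)) :=
      Continuous.tendsto (by fun_prop) s
    refine nhdsWithin_le_nhds ?_
    filter_upwards [hc.eventually (gt_mem_nhds hsp), lt_mem_nhds hp0, lt_mem_nhds h]
      with t ht1 ht2 ht3
    refine lt_of_le_of_lt ?_ ht1
    refine mul_le_mul_of_nonneg_left (le_of_not_gt fun hcon => ?_) ht3.le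
    -- Here `t` may exceed `1`, where the set of prices is empty and its `sSup` is `0`; this is
    -- ruled out by `0 ≤ priceAt D s < p`.
    obtain ⟨p', hp', hlt⟩ := exists_lt_of_lt_csSup (s := {p : ℝ | t ≤ D.real (Ici p)})
      (by
        by_contra hne
        rw [not_nonempty_iff_eq_empty] at hne
        have h0 := priceAt_nonneg hpos hint hs
        rw [priceAt, hne, Real.sSup_empty] at hcon
        linarith) hcon
    exact absurd (le_trans (show t ≤ D.real (Ici p') from hp') (measureReal_mono (Ici_subset_Ici.2 hlt.le)))
      (not_le.2 ht2)

/-! ### The ironed revenue curve -/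

/-- The affine function `c + d * t` lies above the revenue curve on `[0, 1]`. -/
def IsMajorant (D : Measure ℝ) (c d : ℝ) : Prop :=
  ∀ t ∈ Icc (0 : ℝ) 1, revenueCurve D t ≤ c + d * t

theorem ironedCurve_le {D : Measure ℝ} {c d q : ℝ} (h : IsMajorant D c d) (hq : q ∈ Icc (0 : ℝ) 1) :
    ironedCurve D q ≤ c + d * q := by
  refine csInf_le ⟨revenueCurve D q, ?_⟩ ⟨c, d, h, rfl⟩
  rintro y ⟨c', d', h', rfl⟩
  exact h' q hq

section hull

variable {D : Measure ℝ} [IsProbabilityMeasure D]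

theorem isMajorant_integral_max (hpos : D (Iio 0) = 0) (hint : Integrable (fun x : ℝ => x) D)
    (M : ℝ) : IsMajorant D (∫ x, max (x - M) 0 ∂D) M := fun t ht => by
  have := revenueCurve_le (M := M) hpos hint ht
  linarith

theorem le_ironedCurve (hpos : D (Iio 0) = 0) (hint : Integrable (fun x : ℝ => x) D) {q y : ℝ}
    (h : ∀ c d, IsMajorant D c d → y ≤ c + d * q) : y ≤ ironedCurve D q := by
  refine le_csInf ⟨_, _, _, isMajorant_integral_max hpos hint 0, rfl⟩ ?_
  rintro y ⟨c, d, h', rfl⟩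
  exact h c d h'

theorem revenueCurve_le_ironedCurve (hpos : D (Iio 0) = 0)
    (hint : Integrable (fun x : ℝ => x) D) {q : ℝ} (hq : q ∈ Icc (0 : ℝ) 1) :
    revenueCurve D q ≤ ironedCurve D q :=
  le_ironedCurve hpos hint fun _ _ h => h q hq

theorem ironedCurve_zero (hpos : D (Iio 0) = 0) (hint : Integrable (fun x : ℝ => x) D) :
    ironedCurve D 0 = 0 := by
  have h0 : (0 : ℝ) ∈ Icc (0 : ℝ) 1 := by simp
  refine le_antisymm ?_ ?_
  · refine ge_of_tendsto (tendsto_integral_max_sub D hint) (Filter.Eventually.of_forall fun k => ?_)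
    simpa using ironedCurve_le (isMajorant_integral_max hpos hint k) h0
  · simpa [revenueCurve_zero] using revenueCurve_le_ironedCurve hpos hint h0

theorem ironedCurve_one (hpos : D (Iio 0) = 0) (hint : Integrable (fun x : ℝ => x) D) :
    ironedCurve D 1 = revenueCurve D 1 := by
  have h1 : (1 : ℝ) ∈ Icc (0 : ℝ) 1 := by simp
  refine le_antisymm (le_of_forall_pos_lt_add fun ε hε => ?_)
    (revenueCurve_le_ironedCurve hpos hint h1)
  have husc := upperSemicontinuousOn_revenueCurve hpos hint 1 h1 (revenueCurve D 1 + ε / 2)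
    (by linarith)
  obtain ⟨δ, hδ, hball⟩ := Metric.mem_nhdsWithin_iff.1 husc
  set B := ∫ x, max (x - 0) 0 ∂D
  have hB : 0 ≤ B := integral_nonneg fun x => le_max_right _ _
  have hR1 := revenueCurve_nonneg hpos hint h1
  -- The line of slope `-B / δ` through `(1, R(1) + ε / 2)`: semicontinuity keeps `R` below it
  -- within `δ` of `1`, and further away it already exceeds the global bound `B`.
  have hmaj : IsMajorant D (revenueCurve D 1 + ε / 2 + B / δ) (-(B / δ)) := by
    intro t ht
    have hBδ : 0 ≤ B / δ := by positivity
    by_cases htδ : 1 - t < δ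
    · have h2 : revenueCurve D t < revenueCurve D 1 + ε / 2 := by
        refine hball ⟨?_, ht⟩
        rw [Metric.mem_ball, Real.dist_eq, abs_sub_comm, abs_of_nonneg (by linarith [ht.2])]
        exact htδ
      nlinarith [ht.2]
    · have h2 := revenueCurve_le (M := 0) hpos hint ht
      have h3 : B ≤ B / δ * (1 - t) := by
        rw [div_mul_eq_mul_div, le_div_iff₀ hδ]
        exact mul_le_mul_of_nonneg_left (not_lt.1 htδ) hB
      linarith
  have := ironedCurve_le hmaj h1
  linarith

/-- Compactness: a majorant is nonnegative at `0` and at `1`, so for interior `q` a bound on its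
value at `q` bounds both coefficients. At the endpoints steeper and steeper majorants may be
required. -/
theorem exists_isMajorant_eq_ironedCurve (hpos : D (Iio 0) = 0)
    (hint : Integrable (fun x : ℝ => x) D) {q : ℝ} (hq : q ∈ Ioo (0 : ℝ) 1) :
    ∃ c d, IsMajorant D c d ∧ ironedCurve D q = c + d * q := by
  have h0 : (0 : ℝ) ∈ Icc (0 : ℝ) 1 := by simp
  have h1 : (1 : ℝ) ∈ Icc (0 : ℝ) 1 := by simp
  have hq' : q ∈ Icc (0 : ℝ) 1 := ⟨hq.1.le, hq.2.le⟩
  have hq0 := hq.1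
  have hq1 : 0 < 1 - q := by linarith [hq.2]
  set M := ∫ x, max (x - 0) 0 ∂D
  set S : Set (ℝ × ℝ) := {p | IsMajorant D p.1 p.2} ∩ {p | p.1 + p.2 * q ≤ M}
  have hclosed : IsClosed S := by
    refine IsClosed.inter ?_ (isClosed_le (by fun_prop) (by fun_prop))
    have : {p : ℝ × ℝ | IsMajorant D p.1 p.2}
        = ⋂ t ∈ Icc (0 : ℝ) 1, {p : ℝ × ℝ | revenueCurve D t ≤ p.1 + p.2 * t} := by
      ext p; simp [IsMajorant]
    rw [this]
    exact isClosed_biInter fun t _ => isClosed_le (by fun_prop) (by fun_prop)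
  have hsub : S ⊆ Icc 0 (M / (1 - q)) ×ˢ Icc (-(M / (1 - q))) (M / q) := by
    rintro ⟨c, d⟩ ⟨hm, hM⟩
    have e0 := (revenueCurve_nonneg hpos hint h0).trans (hm 0 h0)
    have e1 := (revenueCurve_nonneg hpos hint h1).trans (hm 1 h1)
    simp only [mul_zero, add_zero, mul_one] at e0 e1
    have hM' : c + d * q ≤ M := hM
    have hc : c ≤ M / (1 - q) := by rw [le_div_iff₀ hq1]; nlinarith
    have hd : d ≤ M / q := by rw [le_div_iff₀ hq0]; nlinarith
    exact ⟨⟨e0, hc⟩, ⟨by show -(M / (1 - q)) ≤ d; linarith, hd⟩⟩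
  have hcomp : IsCompact S := (isCompact_Icc.prod isCompact_Icc).of_isClosed_subset hclosed hsub
  have hne : ((M, 0) : ℝ × ℝ) ∈ S :=
    ⟨isMajorant_integral_max hpos hint 0, by simp⟩
  obtain ⟨p, hp, hmin⟩ := hcomp.exists_isMinOn ⟨_, hne⟩
    (f := fun p : ℝ × ℝ => p.1 + p.2 * q) (by fun_prop)
  refine ⟨p.1, p.2, hp.1, le_antisymm (ironedCurve_le hp.1 hq') ?_⟩
  refine le_ironedCurve hpos hint fun c d h => ?_
  by_cases hcd : c + d * q ≤ M
  · exact hmin (show (c, d) ∈ S from ⟨h, hcd⟩)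
  · exact le_trans hp.2 (not_le.1 hcd).le

/-- An optimal majorant touches the curve on every half line that contains `q` in its interior. -/
theorem exists_contact_of_pos (hpos : D (Iio 0) = 0) (hint : Integrable (fun x : ℝ => x) D)
    {q c d : ℝ} (hq : q ∈ Icc (0 : ℝ) 1) (hmaj : IsMajorant D c d)
    (heq : ironedCurve D q = c + d * q) (α β : ℝ) (hg : 0 < α + β * q) :
    ∃ s ∈ Icc (0 : ℝ) 1, 0 ≤ α + β * s ∧ c + d * s ≤ revenueCurve D s := by
  by_contra! hcon
  have hN : IsCompact (Icc (0 : ℝ) 1 ∩ {t | 0 ≤ α + β * t}) :=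
    isCompact_Icc.inter_right (isClosed_le (by fun_prop) (by fun_prop))
  have husc : UpperSemicontinuousOn (fun t => revenueCurve D t + -(c + d * t))
      (Icc (0 : ℝ) 1 ∩ {t | 0 ≤ α + β * t}) :=
    ((upperSemicontinuousOn_revenueCurve hpos hint).mono inter_subset_left).add
      (ContinuousOn.upperSemicontinuousOn (by fun_prop))
  have hqN : q ∈ Icc (0 : ℝ) 1 ∩ {t | 0 ≤ α + β * t} := ⟨hq, hg.le⟩
  obtain ⟨s, hs, hmax⟩ := UpperSemicontinuousOn.exists_isMaxOn ⟨q, hqN⟩ hN husc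
  have hη := hcon s hs.1 hs.2
  set η := c + d * s - revenueCurve D s with hηdef
  have hη0 : 0 < η := by linarith
  -- `G` bounds `α + β * t` on `[0, 1]`. Without contact the gap is at least `η` on the half line,
  -- so subtracting `(η / G) * (α + β * t)` keeps a majorant there, raises it elsewhere, and lowers
  -- it at `q`, against optimality.
  set G := |α| + |β| + 1
  have hG : 0 < G := by positivity
  have hmaj' : IsMajorant D (c - η / G * α) (d - η / G * β) := by
    intro t ht
    have e : c - η / G * α + (d - η / G * β) * t = c + d * t - η / G * (α + β * t) := by ring
    rw [e]
    by_cases htN : 0 ≤ α + β * t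
    · have h1 : revenueCurve D t + -(c + d * t) ≤ revenueCurve D s + -(c + d * s) :=
        isMaxOn_iff.1 hmax t ⟨ht, htN⟩
      have h2 : α + β * t ≤ G := by
        have := le_abs_self α
        have : β * t ≤ |β| := by
          calc β * t ≤ |β * t| := le_abs_self _
            _ = |β| * t := by rw [abs_mul, abs_of_nonneg ht.1]
            _ ≤ |β| * 1 := mul_le_mul_of_nonneg_left ht.2 (abs_nonneg _)
            _ = |β| := mul_one _
        show _ ≤ |α| + |β| + 1
        linarith
      have h3 : η / G * (α + β * t) ≤ η := by
        calc η / G * (α + β * t) ≤ η / G * G := mul_le_mul_of_nonneg_left h2 (by positivity)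
          _ = η := by field_simp
      linarith
    · have h1 := hmaj t ht
      have : η / G * (α + β * t) ≤ 0 :=
        mul_nonpos_of_nonneg_of_nonpos (by positivity) (not_le.1 htN).le
      linarith
  have h1 := ironedCurve_le hmaj' hq
  have h2 : 0 < η / G * (α + β * q) := by positivity
  nlinarith

/-- Around a point `q` the ironed curve is affine between two points of contact. -/
theorem exists_contact_interval (hpos : D (Iio 0) = 0) (hint : Integrable (fun x : ℝ => x) D)
    {q : ℝ} (hq : q ∈ Ioo (0 : ℝ) 1) :
    ∃ c d a b, ironedCurve D q = c + d * q ∧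
      IsGreatest {s : ℝ | s ∈ Icc 0 q ∧ revenueCurve D s = ironedCurve D s} a ∧
      IsLeast {s : ℝ | s ∈ Icc q 1 ∧ revenueCurve D s = ironedCurve D s} b ∧
      revenueCurve D a = c + d * a ∧ revenueCurve D b = c + d * b := by
  have hq' : q ∈ Icc (0 : ℝ) 1 := ⟨hq.1.le, hq.2.le⟩
  obtain ⟨c, d, hmaj, heq⟩ := exists_isMajorant_eq_ironedCurve hpos hint hq
  have husc : UpperSemicontinuousOn (fun t => revenueCurve D t + -(c + d * t)) (Icc (0 : ℝ) 1) :=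
    (upperSemicontinuousOn_revenueCurve hpos hint).add
      (ContinuousOn.upperSemicontinuousOn (by fun_prop))
  set K : Set ℝ := Icc (0 : ℝ) 1 ∩ {t | c + d * t ≤ revenueCurve D t} with hKdef
  have hK : IsCompact K := by
    have := husc.isCompact_inter_preimage_Ici isCompact_Icc 0
    convert this using 2
    ext t
    show c + d * t ≤ revenueCurve D t ↔ 0 ≤ revenueCurve D t + -(c + d * t)
    constructor <;> intro h <;> linarith
  have hcontact : ∀ s ∈ K, revenueCurve D s = ironedCurve D s ∧ revenueCurve D s = c + d * s :=
    fun s hs => by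
      have h1 := hmaj s hs.1
      have h2 := revenueCurve_le_ironedCurve hpos hint hs.1
      have h3 := ironedCurve_le hmaj hs.1
      have h4 : c + d * s ≤ revenueCurve D s := hs.2
      exact ⟨le_antisymm h2 (h3.trans h4), le_antisymm h1 h4⟩
  have hKne : K.Nonempty := by
    obtain ⟨s, hs, -, hs'⟩ := exists_contact_of_pos hpos hint hq' hmaj heq 1 0 (by simp)
    exact ⟨s, hs, hs'⟩
  have hs1K := hK.sInf_mem hKne
  have hs2K := hK.sSup_mem hKne
  set s1 := sInf K
  set s2 := sSup K
  have hs1 : s1 ≤ q := by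
    refine le_of_forall_pos_le_add fun ε hε => ?_
    obtain ⟨s, hs, hle, hs'⟩ :=
      exists_contact_of_pos hpos hint hq' hmaj heq (q + ε) (-1) (by linarith)
    exact (csInf_le hK.bddBelow ⟨hs, hs'⟩).trans (by linarith)
  have hs2 : q ≤ s2 := by
    refine le_of_forall_pos_le_add fun ε hε => ?_
    obtain ⟨s, hs, hle, hs'⟩ :=
      exists_contact_of_pos hpos hint hq' hmaj heq (-(q - ε)) 1 (by linarith)
    have := le_csSup hK.bddAbove (show s ∈ K from ⟨hs, hs'⟩)
    linarith
  -- Every majorant lies above the line `c + d * t` at `s1` and `s2`, hence between them. So the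
  -- hull dominates the line there, and touching the hull means touching the line.
  have hbetween : ∀ s ∈ Icc s1 s2, revenueCurve D s = ironedCurve D s → s ∈ K := by
    intro s hs hc
    refine ⟨⟨hs1K.1.1.trans hs.1, hs.2.trans hs2K.1.2⟩, ?_⟩
    show c + d * s ≤ revenueCurve D s
    rw [hc]
    refine le_ironedCurve hpos hint fun c' d' h' => ?_
    have e1 := h' s1 hs1K.1
    have e2 := h' s2 hs2K.1
    rw [(hcontact s1 hs1K).2] at e1
    rw [(hcontact s2 hs2K).2] at e2
    rcases le_total d d' with hdd | hdd
    · nlinarith [hs.1]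
    · nlinarith [hs.2]
  obtain ⟨a, ha⟩ := (hK.inter_right (isClosed_Iic (a := q))).exists_isGreatest ⟨s1, hs1K, hs1⟩
  obtain ⟨b, hb⟩ := (hK.inter_right (isClosed_Ici (a := q))).exists_isLeast ⟨s2, hs2K, hs2⟩
  refine ⟨c, d, a, b, heq, ⟨⟨⟨ha.1.1.1.1, ha.1.2⟩, (hcontact a ha.1.1).1⟩, ?_⟩,
    ⟨⟨⟨hb.1.2, hb.1.1.1.2⟩, (hcontact b hb.1.1).1⟩, ?_⟩,
    (hcontact a ha.1.1).2, (hcontact b hb.1.1).2⟩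
  · rintro s ⟨hs, hc⟩
    rcases le_total s s1 with h | h
    · exact h.trans (ha.2 ⟨hs1K, hs1⟩)
    · exact ha.2 ⟨hbetween s ⟨h, hs.2.trans hs2⟩ hc, hs.2⟩
  · rintro s ⟨hs, hc⟩
    rcases le_total s2 s with h | h
    · exact (hb.2 ⟨hs2K, hs2⟩).trans h
    · exact hb.2 ⟨hbetween s ⟨hs1.trans hs.1, h⟩ hc, hs.1⟩

end hull

/-! ### Regular distributions -/

theorem measureReal_Ioi_priceAt_le {D : Measure ℝ} [IsProbabilityMeasure D]
    (hint : Integrable (fun x : ℝ => x) D) {q : ℝ} (hq : 0 < q) :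
    D.real (Ioi (priceAt D q)) ≤ q := by
  set P := priceAt D q with hP
  have hmono : Monotone fun k : ℕ => Ici (P + 1 / ((k : ℝ) + 1)) := fun k l hkl =>
    Ici_subset_Ici.2 (add_le_add_right (Nat.one_div_le_one_div hkl) _)
  have hlim := tendsto_measure_iUnion_atTop (μ := D) hmono
  have hUnion : ⋃ k : ℕ, Ici (P + 1 / ((k : ℝ) + 1)) = Ioi P := by
    ext x
    simp only [mem_iUnion, mem_Ici, mem_Ioi]
    refine ⟨fun ⟨k, hk⟩ => ?_, fun h => ?_⟩
    · have : (0 : ℝ) < 1 / ((k : ℝ) + 1) := by positivity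
      linarith
    · obtain ⟨k, hk⟩ := exists_nat_one_div_lt (sub_pos.2 h)
      exact ⟨k, by linarith⟩
  rw [hUnion] at hlim
  have hlim' := (ENNReal.tendsto_toReal (measure_ne_top D (Ioi P))).comp hlim
  refine le_of_tendsto hlim' (Filter.Eventually.of_forall fun k => ?_)
  by_contra hcon
  have hk : (0 : ℝ) < 1 / ((k : ℝ) + 1) := by positivity
  have := le_priceAt D hint (p := P + 1 / ((k : ℝ) + 1)) hq (not_le.1 hcon).le
  linarith

section regular

variable {D : Measure ℝ} [IsProbabilityMeasure D] {f : ℝ → ℝ}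

theorem IsRegularDensity.noAtoms {D : Measure ℝ} {f : ℝ → ℝ} (hf : IsRegularDensity D f) :
    NullSingletonClass D := by
  refine ⟨fun x => ?_⟩
  rw [hf.2.2.1]
  exact withDensity_absolutelyContinuous _ _ (measure_singleton x)

theorem IsRegularDensity.integrable (hf : IsRegularDensity D f) : Integrable f volume := by
  refine ⟨hf.1.aestronglyMeasurable, ?_⟩
  rw [hasFiniteIntegral_iff_ofReal (ae_of_all _ hf.2.1)]
  have h : D univ = ∫⁻ x, ENNReal.ofReal (f x) := by
    conv_lhs => rw [hf.2.2.1]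
    rw [withDensity_apply _ MeasurableSet.univ, Measure.restrict_univ]
  rw [← h]
  exact measure_lt_top _ _

theorem IsRegularDensity.measureReal_eq {D : Measure ℝ} {f : ℝ → ℝ} (hf : IsRegularDensity D f)
    {s : Set ℝ} (hs : MeasurableSet s) : D.real s = ∫ x in s, f x := by
  rw [integral_eq_lintegral_of_nonneg_ae (ae_of_all _ hf.2.1) hf.1.aestronglyMeasurable,
    measureReal_def]
  conv_lhs => rw [hf.2.2.1]
  rw [withDensity_apply _ hs]

/-- The function `x ↦ (x - c) * P(V > x)` is revenue minus `c` times quantile. It is absolutely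
continuous, and the sign of its derivative tells whether the virtual value is below or above `c`. -/
theorem IsRegularDensity.integral_eq_sub (hf : IsRegularDensity D f) {v w : ℝ} (hvw : v ≤ w)
    (c : ℝ) : ∃ g : ℝ → ℝ, (∀ᵐ x, x ∈ uIcc v w → g x = D.real (Ioi x) - (x - c) * f x) ∧
      ∫ x in v..w, g x = (w - c) * D.real (Ioi w) - (v - c) * D.real (Ioi v) := by
  have hfi : IntervalIntegrable f volume v w := hf.integrable.intervalIntegrable
  have hH : ∀ x, v ≤ x → D.real (Ioi x) = D.real (Ioi v) - ∫ t in v..x, f t := by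
    intro x hx
    rw [intervalIntegral.integral_of_le hx, ← hf.measureReal_eq measurableSet_Ioc,
      ← Ioc_union_Ioi_eq_Ioi hx, measureReal_union (Ioc_disjoint_Ioi le_rfl) measurableSet_Ioi]
    ring
  have hac1 : AbsolutelyContinuousOnInterval (fun x => ∫ t in v..x, f t) v w :=
    hfi.absolutelyContinuousOnInterval_intervalIntegral (by simp)
  have hconst : ∀ k : ℝ, AbsolutelyContinuousOnInterval (fun _ => k) v w := fun k =>
    (LipschitzWith.const k).lipschitzOnWith.absolutelyContinuousOnInterval
  have hac2 : AbsolutelyContinuousOnInterval (fun x : ℝ => x) v w :=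
    LipschitzWith.id.lipschitzOnWith.absolutelyContinuousOnInterval
  have hac := (hac2.fun_sub (hconst c)).fun_mul ((hconst (D.real (Ioi v))).fun_sub hac1)
  refine ⟨_, ?_, hac.integral_deriv_eq_sub.trans ?_⟩
  · filter_upwards [hfi.ae_hasDerivAt_integral] with x hx hxI
    have h1 : HasDerivAt (fun x => ∫ t in v..x, f t) (f x) x := hx hxI v (by simp)
    have h2 : HasDerivAt (fun x : ℝ => x - c) 1 x := (hasDerivAt_id x).sub_const c
    have h3 := h2.fun_mul (h1.const_sub (D.real (Ioi v)))
    rw [h3.deriv, hH x (by rw [uIcc_of_le hvw] at hxI; exact hxI.1)]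
    ring
  · rw [hH w hvw]
    simp

theorem IsRegularDensity.le_of_virtual_le (hf : IsRegularDensity D f) {v w : ℝ} (hvw : v ≤ w)
    (c : ℝ) (h : ∀ x ∈ Icc v w, (x - c) * f x ≤ D.real (Ioi x)) :
    (v - c) * D.real (Ioi v) ≤ (w - c) * D.real (Ioi w) := by
  obtain ⟨g, hg, hint⟩ := hf.integral_eq_sub hvw c
  have : 0 ≤ ∫ x in v..w, g x := by
    refine intervalIntegral.integral_nonneg_of_ae_restrict hvw ?_
    filter_upwards [ae_restrict_of_ae hg, ae_restrict_mem measurableSet_Icc] with x hx hxI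
    rw [hx (by rwa [uIcc_of_le hvw])]
    exact sub_nonneg.2 (h x hxI)
  linarith

theorem IsRegularDensity.le_of_le_virtual (hf : IsRegularDensity D f) {v w : ℝ} (hvw : v ≤ w)
    (c : ℝ) (h : ∀ x ∈ Icc v w, D.real (Ioi x) ≤ (x - c) * f x) :
    (w - c) * D.real (Ioi w) ≤ (v - c) * D.real (Ioi v) := by
  obtain ⟨g, hg, hint⟩ := hf.integral_eq_sub hvw c
  have : 0 ≤ ∫ x in v..w, -g x := by
    refine intervalIntegral.integral_nonneg_of_ae_restrict hvw ?_
    filter_upwards [ae_restrict_of_ae hg, ae_restrict_mem measurableSet_Icc] with x hx hxI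
    rw [hx (by rwa [uIcc_of_le hvw])]
    have := h x hxI
    show (0 : ℝ) ≤ _
    linarith
  rw [intervalIntegral.integral_neg] at this
  linarith

/-- Let `c` be the virtual value at `p = priceAt D q`. As virtual values are monotone, `(x - c) *
P(V > x)` increases up to `p` and decreases afterwards. Being maximal at `p`, it makes the line of
slope `c` through `(q, R(q))` a majorant. -/
theorem IsRegularDensity.ironedCurve_le_revenueCurve (hpos : D (Iio 0) = 0)
    (hint : Integrable (fun x : ℝ => x) D) (hf : IsRegularDensity D f) {q : ℝ}
    (hq : q ∈ Icc (0 : ℝ) 1) : ironedCurve D q ≤ revenueCurve D q := by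
  rcases hq.1.eq_or_lt with h0 | h0
  · subst h0
    rw [ironedCurve_zero hpos hint, revenueCurve_zero]
  rcases hq.2.eq_or_lt with h1 | h1
  · subst h1
    exact (ironedCurve_one hpos hint).le
  have := hf.noAtoms
  have hIoi : ∀ t ∈ Ioc (0 : ℝ) 1, D.real (Ioi (priceAt D t)) = t := fun t ht =>
    le_antisymm (measureReal_Ioi_priceAt_le hint ht.1)
      ((le_measureReal_Ici_priceAt hpos ⟨ht.1.le, ht.2⟩).trans_eq
        (measureReal_congr Ioi_ae_eq_Ici).symm)
  have hIic : ∀ x, D.real (Iic x) = 1 - D.real (Ioi x) := fun x => by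
    rw [← compl_Ioi, probReal_compl_eq_one_sub measurableSet_Ioi]
  set p := priceAt D q with hp
  have hp0 : 0 ≤ p := priceAt_nonneg hpos hint hq
  have hpq : D.real (Ioi p) = q := hIoi q ⟨h0, hq.2⟩
  have hne : ∀ x, virtualValue D f x ≠ ⊥ →
      virtualValue D f x = ((x - D.real (Ioi x) / f x : ℝ) : EReal) := by
    intro x hx
    unfold virtualValue at hx ⊢
    split_ifs at hx ⊢
    · exact absurd rfl hx
    · rw [hIic, sub_sub_cancel]
  have hbot : ∀ x, virtualValue D f x = ⊥ → f x = 0 ∧ D.real (Ioi x) ≠ 0 := by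
    intro x hx
    unfold virtualValue at hx
    split_ifs at hx with h
    · refine ⟨h.1, ?_⟩
      have := h.2
      rw [hIic] at this
      linarith
    · exact absurd hx (EReal.coe_ne_bot _)
  -- Otherwise monotonicity makes the virtual value `-∞`, and so the density zero, on all of `[0,
  -- p)`; then nothing lies below `p` and `q = 1`.
  have hp_ne : virtualValue D f p ≠ ⊥ := by
    intro hcon
    have hzero : ∀ x ∈ Ico 0 p, f x = 0 := fun x hx => by
      refine (hbot x (le_bot_iff.1 ?_)).1
      rw [← hcon]
      exact hf.2.2.2 hx.1 hp0 hx.2.le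
    have h2 : D.real (Ico 0 p) = 0 := by
      rw [hf.measureReal_eq measurableSet_Ico]
      exact setIntegral_eq_zero_of_forall_eq_zero hzero
    have hdisj : Disjoint (Ico 0 p) (Ici p) := disjoint_left.2 fun x hx => not_le.2 hx.2
    have h3 : D.real (Ici 0) = D.real (Ico 0 p) + D.real (Ici p) := by
      rw [← Ico_union_Ici_eq_Ici hp0,
        measureReal_union hdisj measurableSet_Ici]
    rw [measureReal_Ici_eq_one hpos le_rfl, h2, ← measureReal_congr Ioi_ae_eq_Ici, hpq] at h3
    linarith
  set c := p - D.real (Ioi p) / f p with hc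
  have hcv : virtualValue D f p = (c : EReal) := hne p hp_ne
  have hlow : ∀ x ∈ Icc 0 p, (x - c) * f x ≤ D.real (Ioi x) := by
    intro x hx
    rcases (hf.2.1 x).eq_or_lt with hfx | hfx
    · rw [← hfx, mul_zero]; exact measureReal_nonneg
    · have h2 := hf.2.2.2 hx.1 hp0 hx.2
      rw [hcv, hne x (fun hcon => hfx.ne' (hbot x hcon).1), EReal.coe_le_coe_iff] at h2
      rw [← le_div_iff₀ hfx]
      linarith
  have hhigh : ∀ x, p ≤ x → D.real (Ioi x) ≤ (x - c) * f x := by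
    intro x hx
    have h2 := hf.2.2.2 hp0 (hp0.trans hx) hx
    have hx_ne : virtualValue D f x ≠ ⊥ := fun hcon => by
      rw [hcon, hcv] at h2
      exact EReal.coe_ne_bot _ (le_bot_iff.1 h2)
    rcases (hf.2.1 x).eq_or_lt with hfx | hfx
    · rw [← hfx, mul_zero]
      by_contra hcon
      refine hx_ne (if_pos ⟨hfx.symm, ?_⟩)
      rw [hIic]
      linarith
    · rw [hcv, hne x hx_ne, EReal.coe_le_coe_iff] at h2
      rw [← div_le_iff₀ hfx]
      linarith
  have hmaj : IsMajorant D ((p - c) * q) c := by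
    intro t ht
    rcases ht.1.eq_or_lt with ht0 | ht0
    · rw [← ht0, revenueCurve_zero, mul_zero, add_zero]
      refine mul_nonneg ?_ h0.le
      rw [hc, sub_sub_cancel]
      exact div_nonneg measureReal_nonneg (hf.2.1 p)
    · have hv0 := priceAt_nonneg hpos hint ht
      have hvt := hIoi t ⟨ht0, ht.2⟩
      have key : (priceAt D t - c) * t ≤ (p - c) * q := by
        rcases le_total (priceAt D t) p with h | h
        · have := hf.le_of_virtual_le h c fun x hx => hlow x ⟨hv0.trans hx.1, hx.2⟩
          rwa [hvt, hpq] at this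
        · have := hf.le_of_le_virtual h c fun x hx => hhigh x hx.1
          rwa [hvt, hpq] at this
      rw [revenueCurve]
      linarith
  refine (ironedCurve_le hmaj hq).trans_eq ?_
  rw [revenueCurve, ← hp]
  ring

end regular

/-! ### The price lottery -/

section lottery

variable {D : Measure ℝ} [IsProbabilityMeasure D]

/-- Without ironing `a = b = q`, and the weight is `0 / 0 = 0`. Otherwise `q` is interior, because
hull and curve agree at `0` and `1`, and both contact points lie on a line through the hull at `q`,
so mixing them reproduces its value. -/
theorem ironing_interval (hpos : D (Iio 0) = 0) (hint : Integrable (fun x : ℝ => x) D) {q : ℝ}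
    (hq : q ∈ Icc (0 : ℝ) 1) :
    lowerQuantile D q ∈ Icc 0 q ∧ upperQuantile D q ∈ Icc q 1 ∧ mixWeight D q ∈ Icc (0 : ℝ) 1 ∧
      mixWeight D q * upperQuantile D q + (1 - mixWeight D q) * lowerQuantile D q = q ∧
      ironedCurve D q ≤ mixWeight D q * revenueCurve D (upperQuantile D q)
        + (1 - mixWeight D q) * revenueCurve D (lowerQuantile D q) := by
  have hsame : lowerQuantile D q = q → upperQuantile D q = q →
      ironedCurve D q ≤ revenueCurve D q → lowerQuantile D q ∈ Icc 0 q ∧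
      upperQuantile D q ∈ Icc q 1 ∧ mixWeight D q ∈ Icc (0 : ℝ) 1 ∧
      mixWeight D q * upperQuantile D q + (1 - mixWeight D q) * lowerQuantile D q = q ∧
      ironedCurve D q ≤ mixWeight D q * revenueCurve D (upperQuantile D q)
        + (1 - mixWeight D q) * revenueCurve D (lowerQuantile D q) := by
    intro ha hb hR
    have hx : mixWeight D q = 0 := by rw [mixWeight, ha, sub_self, zero_div]
    rw [hx, ha, hb]
    exact ⟨⟨hq.1, le_rfl⟩, ⟨le_rfl, hq.2⟩, ⟨le_rfl, zero_le_one⟩, by ring, by simpa using hR⟩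
  by_cases hreg : IsRegularDist D
  · obtain ⟨f, hf⟩ := hreg
    exact hsame (if_pos ⟨f, hf⟩) (if_pos ⟨f, hf⟩) (hf.ironedCurve_le_revenueCurve hpos hint hq)
  have ha : lowerQuantile D q
      = sSup {s : ℝ | s ∈ Icc 0 q ∧ revenueCurve D s = ironedCurve D s} := if_neg hreg
  have hb : upperQuantile D q
      = sInf {s : ℝ | s ∈ Icc q 1 ∧ revenueCurve D s = ironedCurve D s} := if_neg hreg
  by_cases hc : revenueCurve D q = ironedCurve D q
  · refine hsame (ha.trans (IsGreatest.csSup_eq ⟨⟨⟨hq.1, le_rfl⟩, hc⟩, fun s hs => hs.1.2⟩))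
      (hb.trans (IsLeast.csInf_eq ⟨⟨⟨le_rfl, hq.2⟩, hc⟩, fun s hs => hs.1.1⟩)) hc.ge
  have hq0 : 0 < q := hq.1.lt_of_ne fun h => hc <| by
    rw [← h, ironedCurve_zero hpos hint, revenueCurve_zero]
  have hq1 : q < 1 := hq.2.lt_of_ne fun h => hc <| by rw [h, ironedCurve_one hpos hint]
  obtain ⟨c, d, a, b, heq, hga, hlb, hRa, hRb⟩ := exists_contact_interval hpos hint ⟨hq0, hq1⟩
  rw [hga.csSup_eq] at ha
  rw [hlb.csInf_eq] at hb
  have haq : a < q := hga.1.1.2.lt_of_ne fun h => hc (h ▸ hga.1.2)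
  have hqb : q < b := hlb.1.1.1.lt_of_ne fun h => hc (h ▸ hlb.1.2)
  have hab : 0 < b - a := by linarith
  have hx : mixWeight D q = (q - a) / (b - a) := by rw [mixWeight, ha, hb]
  have hmix : mixWeight D q * b + (1 - mixWeight D q) * a = q := by
    rw [hx]; field_simp; ring
  refine ⟨ha ▸ hga.1.1, hb ▸ hlb.1.1, ?_, by rw [ha, hb, hmix], ?_⟩
  · rw [hx]
    exact ⟨div_nonneg (by linarith) hab.le, (div_le_one hab).2 (by linarith)⟩
  · rw [ha, hb, heq, hRa, hRb]
    refine le_of_eq ?_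
    conv_lhs => rw [← hmix]
    ring

theorem postProb_mem (hpos : D (Iio 0) = 0) {s : ℝ} (hs : s ∈ Icc (0 : ℝ) 1) :
    postProb D s ∈ Icc (0 : ℝ) 1 :=
  ⟨div_nonneg hs.1 measureReal_nonneg,
    div_le_one_of_le₀ (le_measureReal_Ici_priceAt hpos hs) measureReal_nonneg⟩

theorem postProb_mul (hpos : D (Iio 0) = 0) {s : ℝ} (hs : s ∈ Icc (0 : ℝ) 1) :
    postProb D s * D.real (Ici (priceAt D s)) = s := by
  have h := le_measureReal_Ici_priceAt hpos hs
  rcases hs.1.eq_or_lt with h0 | h0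
  · rw [postProb, ← h0, zero_div, zero_mul]
  · exact div_mul_cancel₀ _ (h0.trans_le h).ne'

theorem setOf_accepts_some (p : ℝ) : {x | Accepts (some p) x} = Ici p := by
  ext x; simp [Accepts]

theorem setOf_accepts_none : {x | Accepts none x} = ∅ := by
  ext x; simp [Accepts]

theorem offerProb_nonneg (hpos : D (Iio 0) = 0) (hint : Integrable (fun x : ℝ => x) D) {q : ℝ}
    (hq : q ∈ Icc (0 : ℝ) 1) (k : Fin 3) : 0 ≤ offerProb D q k := by
  obtain ⟨ha, hb, hx, -, -⟩ := ironing_interval hpos hint hq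
  have pa := postProb_mem hpos (D := D) ⟨ha.1, ha.2.trans hq.2⟩
  have pb := postProb_mem hpos (D := D) ⟨hq.1.trans hb.1, hb.2⟩
  have h1 := mul_nonneg hx.1 pb.1
  have h2 := mul_nonneg (sub_nonneg.2 hx.2) pa.1
  have h3 := mul_le_mul_of_nonneg_left pb.2 hx.1
  have h4 := mul_le_mul_of_nonneg_left pa.2 (sub_nonneg.2 hx.2)
  fin_cases k
  · exact h1
  · exact h2
  · show 0 ≤ 1 - mixWeight D q * postProb D (upperQuantile D q)
      - (1 - mixWeight D q) * postProb D (lowerQuantile D q)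
    linarith

theorem sum_offerProb {D : Measure ℝ} (q : ℝ) : ∑ k, offerProb D q k = 1 := by
  simp [Fin.sum_univ_three, offerProb]

theorem sum_offerProb_mul_accepts (hpos : D (Iio 0) = 0) (hint : Integrable (fun x : ℝ => x) D)
    {q : ℝ} (hq : q ∈ Icc (0 : ℝ) 1) :
    ∑ k, offerProb D q k * D.real {x | Accepts (offer D q k) x} = q := by
  obtain ⟨ha, hb, hx, hmix, -⟩ := ironing_interval hpos hint hq
  have pa := postProb_mul hpos (D := D) ⟨ha.1, ha.2.trans hq.2⟩
  have pb := postProb_mul hpos (D := D) ⟨hq.1.trans hb.1, hb.2⟩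
  simp only [Fin.sum_univ_three, offerProb, offer, Matrix.cons_val, setOf_accepts_some,
    setOf_accepts_none, measureReal_empty, mul_zero, add_zero]
  rw [mul_assoc, mul_assoc, pa, pb, hmix]

theorem effectivePrice_mul (hpos : D (Iio 0) = 0) (hint : Integrable (fun x : ℝ => x) D)
    {q : ℝ} (hq : q ∈ Icc (0 : ℝ) 1) :
    effectivePrice D q * q = mixWeight D q * revenueCurve D (upperQuantile D q)
        + (1 - mixWeight D q) * revenueCurve D (lowerQuantile D q) := by
  obtain ⟨ha, hb, hx, hmix, -⟩ := ironing_interval hpos hint hq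
  rcases eq_or_ne q 0 with h0 | h0
  · subst h0
    -- The left side is a product with `0`; on the right `a = 0`, and the mixing identity becomes `x
    -- * b = 0`, so nothing is lost when `b` is positive.
    have ha0 : lowerQuantile D 0 = 0 := le_antisymm ha.2 ha.1
    rw [ha0, mul_zero, add_zero] at hmix
    rw [mul_zero, ha0, revenueCurve_zero, revenueCurve, ← mul_assoc, hmix]
    ring
  · exact div_mul_cancel₀ _ h0

theorem sum_offerProb_mul_price (hpos : D (Iio 0) = 0) (hint : Integrable (fun x : ℝ => x) D)
    {q : ℝ} (hq : q ∈ Icc (0 : ℝ) 1) :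
    ∑ k, offerProb D q k * ((offer D q k).getD 0 * D.real {x | Accepts (offer D q k) x})
      = effectivePrice D q * q := by
  rw [effectivePrice_mul hpos hint hq]
  obtain ⟨ha, hb, hx, hmix, -⟩ := ironing_interval hpos hint hq
  have pa := postProb_mul hpos (D := D) ⟨ha.1, ha.2.trans hq.2⟩
  have pb := postProb_mul hpos (D := D) ⟨hq.1.trans hb.1, hb.2⟩
  simp only [Fin.sum_univ_three, offerProb, offer, Matrix.cons_val, setOf_accepts_some,
    setOf_accepts_none, measureReal_empty, mul_zero, add_zero, Option.getD_some, revenueCurve]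
  linear_combination mixWeight D q * priceAt D (upperQuantile D q) * pb
    + (1 - mixWeight D q) * priceAt D (lowerQuantile D q) * pa

theorem effectivePrice_nonneg (hpos : D (Iio 0) = 0) (hint : Integrable (fun x : ℝ => x) D)
    {q : ℝ} (hq : q ∈ Icc (0 : ℝ) 1) : 0 ≤ effectivePrice D q := by
  obtain ⟨ha, hb, hx, -, -⟩ := ironing_interval hpos hint hq
  exact div_nonneg (add_nonneg
    (mul_nonneg hx.1 (revenueCurve_nonneg hpos hint ⟨hq.1.trans hb.1, hb.2⟩))
    (mul_nonneg (sub_nonneg.2 hx.2) (revenueCurve_nonneg hpos hint ⟨ha.1, ha.2.trans hq.2⟩))) hq.1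

theorem ironedCurve_le_effectivePrice_mul (hpos : D (Iio 0) = 0)
    (hint : Integrable (fun x : ℝ => x) D) {q : ℝ} (hq : q ∈ Icc (0 : ℝ) 1) :
    ironedCurve D q ≤ effectivePrice D q * q :=
  (ironing_interval hpos hint hq).2.2.2.2.trans_eq (effectivePrice_mul hpos hint hq).symm

end lottery

/-! ### Virtual values are monotone -/

section virtual

variable {D : Measure ℝ} [IsProbabilityMeasure D]

theorem concaveOn_ironedCurve (hpos : D (Iio 0) = 0) (hint : Integrable (fun x : ℝ => x) D) :
    ConcaveOn ℝ (Icc 0 1) (ironedCurve D) := by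
  refine ⟨convex_Icc 0 1, fun x hx y hy a b ha hb hab => ?_⟩
  refine le_ironedCurve hpos hint fun c d h => ?_
  have h1 := mul_le_mul_of_nonneg_left (ironedCurve_le h hx) ha
  have h2 := mul_le_mul_of_nonneg_left (ironedCurve_le h hy) hb
  simp only [smul_eq_mul]
  calc _ ≤ a * (c + d * x) + b * (c + d * y) := add_le_add h1 h2
    _ = (a + b) * c + d * (a * x + b * y) := by ring
    _ = _ := by rw [hab, one_mul]

theorem measureReal_Ioi_mem (v : ℝ) : D.real (Ioi v) ∈ Icc (0 : ℝ) 1 :=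
  ⟨measureReal_nonneg, measureReal_le_one⟩

/-- A larger value has a smaller quantile. By concavity each slope to the right of the old quantile
is at most the slope between the two quantiles, which is itself a competitor in the new supremum. -/
theorem monotone_ironedVirtualValue (hpos : D (Iio 0) = 0)
    (hint : Integrable (fun x : ℝ => x) D) : Monotone (ironedVirtualValue D) := by
  intro v w hvw
  have hle : D.real (Ioi w) ≤ D.real (Ioi v) := measureReal_mono (Ioi_subset_Ioi hvw)
  unfold ironedVirtualValue
  rcases hle.eq_or_lt with h | h
  · rw [h]
  refine iSup₂_le fun t ht => ?_
  refine le_trans ?_ (le_iSup₂ (D.real (Ioi v)) ⟨h, (measureReal_Ioi_mem v).2⟩)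
  rw [EReal.coe_le_coe_iff]
  exact (concaveOn_ironedCurve hpos hint).slope_anti_adjacent (measureReal_Ioi_mem w)
    ⟨(measureReal_nonneg).trans ht.1.le, ht.2⟩ h ht.1

/-- At a positive quantile the slope of the chord from `0` bounds all slopes to the right. At
quantile `0` no price above `v` ever sells, so the line of slope `v` through the origin is a
majorant. -/
theorem ironedVirtualValue_ne_top (hpos : D (Iio 0) = 0)
    (hint : Integrable (fun x : ℝ => x) D) (v : ℝ) : ironedVirtualValue D v ≠ ⊤ := by
  suffices h : ∃ B : ℝ, ironedVirtualValue D v ≤ B by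
    obtain ⟨B, hB⟩ := h
    exact ne_top_of_le_ne_top (EReal.coe_ne_top B) hB
  unfold ironedVirtualValue
  set u := D.real (Ioi v) with hu
  have hu01 : u ∈ Icc (0 : ℝ) 1 := measureReal_Ioi_mem v
  rcases hu01.1.eq_or_lt with h | h
  · refine ⟨v, iSup₂_le fun t ht => ?_⟩
    rw [← h] at ht ⊢
    rw [EReal.coe_le_coe_iff, ironedCurve_zero hpos hint, sub_zero, sub_zero, div_le_iff₀ ht.1]
    have hmaj : IsMajorant D 0 v := by
      intro s hs
      rcases hs.1.eq_or_lt with h0 | h0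
      · rw [← h0, revenueCurve_zero]; simp
      · rw [zero_add, revenueCurve, mul_comm]
        refine mul_le_mul_of_nonneg_right ?_ h0.le
        by_contra hcon
        have h1 := le_measureReal_Ici_priceAt hpos hs
        have h2 : D.real (Ici (priceAt D s)) ≤ u :=
          measureReal_mono fun x hx => (not_le.1 hcon).trans_le hx
        linarith
    have := ironedCurve_le hmaj ⟨ht.1.le, ht.2⟩
    linarith
  · refine ⟨(ironedCurve D u - ironedCurve D 0) / (u - 0), iSup₂_le fun t ht => EReal.coe_le_coe_iff.2 ?_⟩
    exact (concaveOn_ironedCurve hpos hint).slope_anti_adjacent (x := 0) (by simp)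
      ⟨h.le.trans ht.1.le, ht.2⟩ h ht.1

theorem measurable_virtualValue {f : ℝ → ℝ} (hf : Measurable f) :
    Measurable (virtualValue D f) := by
  have hF : Measurable fun v : ℝ => D.real (Iic v) :=
    Monotone.measurable fun v w hvw => measureReal_mono (Iic_subset_Iic.2 hvw)
  unfold virtualValue
  refine Measurable.ite ?_ measurable_const ?_
  · exact (hf (measurableSet_singleton 0)).inter (hF measurableSet_Iio)
  · exact measurable_coe_real_ereal.comp (measurable_id.sub ((measurable_const.sub hF).div hf))

theorem virtualValue_ne_top {D : Measure ℝ} (f : ℝ → ℝ) (v : ℝ) : virtualValue D f v ≠ ⊤ := by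
  unfold virtualValue
  split_ifs
  · exact bot_ne_top
  · exact EReal.coe_ne_top _

theorem IsMyersonValue.properties (hpos : D (Iio 0) = 0) (hint : Integrable (fun x : ℝ => x) D)
    {ψ : ℝ → EReal} (h : IsMyersonValue D ψ) :
    Measurable ψ ∧ MonotoneOn ψ (Ici 0) ∧ ∀ v, ψ v ≠ ⊤ := by
  rcases h with ⟨f, hf, rfl⟩ | rfl
  · exact ⟨measurable_virtualValue hf.1, hf.2.2.2, virtualValue_ne_top f⟩
  · exact ⟨(monotone_ironedVirtualValue hpos hint).measurable,
      (monotone_ironedVirtualValue hpos hint).monotoneOn _, ironedVirtualValue_ne_top hpos hint⟩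

end virtual

/-! ### Resampling one coordinate of a product measure -/

section update

variable {ι : Type*} [Fintype ι] [DecidableEq ι] {α : ι → Type*} [∀ i, MeasurableSpace (α i)]
  (μ : ∀ i, Measure (α i)) [∀ i, IsProbabilityMeasure (μ i)]

theorem measurePreserving_update (i : ι) :
    MeasurePreserving (fun p : (∀ j, α j) × α i => Function.update p.1 i p.2)
      ((Measure.pi μ).prod (μ i)) (Measure.pi μ) := by
  refine ⟨measurable_update', (Measure.pi_eq fun s hs => ?_).symm⟩
  rw [Measure.map_apply measurable_update' (MeasurableSet.univ_pi hs)]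
  have hpre : (fun p : (∀ j, α j) × α i => Function.update p.1 i p.2) ⁻¹' univ.pi s
      = (univ.pi (Function.update s i univ)) ×ˢ s i := by
    ext ⟨v, z⟩
    simp only [mem_preimage, mem_pi, mem_univ, true_implies, mem_prod]
    constructor
    · refine fun h => ⟨fun j => ?_, by simpa using h i⟩
      rcases eq_or_ne j i with rfl | hj
      · simp
      · simpa [hj] using h j
    · rintro ⟨h1, h2⟩ j
      rcases eq_or_ne j i with rfl | hj
      · simpa using h2
      · simpa [hj] using h1 j
  rw [hpre, Measure.prod_prod, Measure.pi_pi, ← Finset.prod_erase_mul _ _ (Finset.mem_univ i),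
    ← Finset.prod_erase_mul Finset.univ (fun j => μ j (s j)) (Finset.mem_univ i)]
  simp only [Function.update_self, measure_univ, mul_one]
  congr 1
  refine Finset.prod_congr rfl fun j hj => ?_
  rw [Function.update_of_ne (Finset.ne_of_mem_erase hj)]

variable {μ}

theorem integrable_comp_update {g : (∀ j, α j) → ℝ} (hg : Integrable g (Measure.pi μ)) (i : ι) :
    Integrable (fun p : (∀ j, α j) × α i => g (Function.update p.1 i p.2))
      ((Measure.pi μ).prod (μ i)) :=
  (measurePreserving_update μ i).integrable_comp_of_integrable hg

theorem integral_eq_integral_update {g : (∀ j, α j) → ℝ} (hg : Integrable g (Measure.pi μ))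
    (i : ι) : ∫ v, g v ∂Measure.pi μ
      = ∫ v, ∫ z, g (Function.update v i z) ∂μ i ∂Measure.pi μ := by
  have h := measurePreserving_update μ i
  have hgm : AEStronglyMeasurable g (Measure.map (fun p : (∀ j, α j) × α i =>
      Function.update p.1 i p.2) ((Measure.pi μ).prod (μ i))) := by
    rw [h.map_eq]; exact hg.aestronglyMeasurable
  conv_lhs => rw [← h.map_eq]
  rw [integral_map h.measurable.aemeasurable hgm, integral_prod _ (integrable_comp_update hg i)]

/-- A bounded function that ignores a coordinate is independent of that coordinate. -/
theorem integral_mul_eval_of_forall_update {g : (∀ j, α j) → ℝ} {i : ι} {h : α i → ℝ}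
    (hgh : Integrable (fun v => g v * h (v i)) (Measure.pi μ))
    (hg : ∀ v z, g (Function.update v i z) = g v) :
    ∫ v, g v * h (v i) ∂Measure.pi μ = (∫ v, g v ∂Measure.pi μ) * ∫ z, h z ∂μ i := by
  rw [integral_eq_integral_update hgh i, ← integral_mul_const]
  simp only [hg, Function.update_self, integral_const_mul]

end update

/-! ### The revenue of a monotone allocation rule -/

section truthful

variable {n : ℕ} {D : Fin n → Measure ℝ} [∀ i, IsProbabilityMeasure (D i)]
  {A : (Fin n → ℝ) → Finset (Fin n)}

theorem ae_nonneg_eval (hpos : ∀ i, D i (Iio 0) = 0) (i : Fin n) :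
    ∀ᵐ v ∂Measure.pi D, 0 ≤ v i := by
  have h : ∀ᵐ x ∂D i, 0 ≤ x := by
    rw [ae_iff]
    simpa [Iio] using hpos i
  exact (measurePreserving_eval D i).quasiMeasurePreserving.ae h

theorem truthfulPayment_mem {v : Fin n → ℝ} {i : Fin n} (hv : 0 ≤ v i) :
    truthfulPayment A v i ∈ Icc 0 (v i) := by
  unfold truthfulPayment
  split_ifs with h
  · exact ⟨Real.sInf_nonneg fun z hz => hz.1, csInf_le ⟨0, fun z hz => hz.1⟩
      ⟨hv, by rwa [Function.update_eq_self]⟩⟩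
  · exact ⟨le_rfl, hv⟩

/-- The payment is dominated by the value. For measurability, monotonicity lets rational bids decide
whether the threshold is below `c`. -/
theorem integrable_truthfulPayment (hpos : ∀ i, D i (Iio 0) = 0)
    (hmean : ∀ i, Integrable (fun x : ℝ => x) (D i))
    (hA : ∀ i, MeasurableSet {v | i ∈ A v})
    (hmono : ∀ v i z z', 0 ≤ z → z ≤ z' → i ∈ A (Function.update v i z) →
      i ∈ A (Function.update v i z')) (i : Fin n) :
    Integrable (fun v => truthfulPayment A v i) (Measure.pi D) := by
  have hvi : Integrable (fun v : Fin n → ℝ => v i) (Measure.pi D) :=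
    (measurePreserving_eval D i).integrable_comp_of_integrable (hmean i)
  set B : Set (Fin n → ℝ) := {v | i ∈ A v} ∩ {v | 0 ≤ v i} with hB
  have hBm : MeasurableSet B := (hA i).inter (measurableSet_le measurable_const (measurable_pi_apply i))
  have hmeas : Measurable (B.indicator fun v => truthfulPayment A v i) := by
    refine measurable_of_Iio fun c => ?_
    have hmem : ∀ v ∈ B, (truthfulPayment A v i < c ↔
        ∃ r : ℚ, 0 ≤ (r : ℝ) ∧ (r : ℝ) < c ∧ i ∈ A (Function.update v i r)) := by
      intro v hv
      have hT : truthfulPayment A v i = sInf {z : ℝ | 0 ≤ z ∧ i ∈ A (Function.update v i z)} :=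
        if_pos hv.1
      rw [hT]
      constructor
      · intro h
        have hvi' : v i ∈ {z : ℝ | 0 ≤ z ∧ i ∈ A (Function.update v i z)} :=
          ⟨hv.2, by rw [Function.update_eq_self]; exact hv.1⟩
        obtain ⟨z, hz, hzc⟩ := exists_lt_of_csInf_lt ⟨v i, hvi'⟩ h
        obtain ⟨r, hr1, hr2⟩ := exists_rat_btwn hzc
        exact ⟨r, hz.1.trans hr1.le, hr2, hmono v i z r hz.1 hr1.le hz.2⟩
      · rintro ⟨r, hr0, hrc, hr⟩
        have hr' : (r : ℝ) ∈ {z : ℝ | 0 ≤ z ∧ i ∈ A (Function.update v i z)} := ⟨hr0, hr⟩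
        exact (csInf_le ⟨0, fun z hz => hz.1⟩ hr').trans_lt hrc
    have hset : (B.indicator fun v => truthfulPayment A v i) ⁻¹' Iio c
        = (B ∩ ⋃ r : ℚ, {v | 0 ≤ (r : ℝ) ∧ (r : ℝ) < c ∧ i ∈ A (Function.update v i r)})
          ∪ (Bᶜ ∩ {_v | 0 < c}) := by
      ext v
      by_cases hv : v ∈ B
      · simp [hv, hmem v hv]
      · simp [hv]
    rw [hset]
    refine (hBm.inter (MeasurableSet.iUnion fun r => ?_)).union
      (hBm.compl.inter (MeasurableSet.const _))
    refine (MeasurableSet.const _).inter ((MeasurableSet.const _).inter ?_)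
    exact measurable_update_left (hA i)
  refine hvi.mono' (hmeas.aestronglyMeasurable.congr ?_) ?_
  · filter_upwards [ae_nonneg_eval hpos i] with v hv
    by_cases h : i ∈ A v
    · exact indicator_of_mem (show v ∈ B from ⟨h, hv⟩) _
    · rw [indicator_of_notMem fun hvB : v ∈ B => h hvB.1, truthfulPayment, if_neg h]
  · filter_upwards [ae_nonneg_eval hpos i] with v hv
    have := truthfulPayment_mem (A := A) hv
    rw [Real.norm_of_nonneg this.1]
    exact this.2

/-- For fixed other values the payment is a constant `T` on the event of service, and almost all
served values are at least `T`. Hence the price `T` sells with probability at least `Q`, and `Q * T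
≤ R(Q)`. Working with one majorant at a time replaces Jensen's inequality for the hull by linearity
of the integral. -/
theorem integral_truthfulPayment_le (hpos : ∀ i, D i (Iio 0) = 0)
    (hmean : ∀ i, Integrable (fun x : ℝ => x) (D i))
    (hA : ∀ i, MeasurableSet {v | i ∈ A v})
    (i : Fin n) (hint : Integrable (fun v => truthfulPayment A v i) (Measure.pi D)) :
    ∫ v, truthfulPayment A v i ∂Measure.pi D ≤ ironedCurve (D i) (serviceProb D A i) := by
  refine le_ironedCurve (hpos i) (hmean i) fun c d hmaj => ?_
  set g : (Fin n → ℝ) → ℝ := {v | i ∈ A v}.indicator 1 with hg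
  have hgi : Integrable g (Measure.pi D) := (integrable_const 1).indicator (hA i)
  have hslice : ∀ v, MeasurableSet {z | i ∈ A (Function.update v i z)} := fun v =>
    measurable_update v (hA i)
  set Q : (Fin n → ℝ) → ℝ := fun v => (D i).real {z | i ∈ A (Function.update v i z)} with hQdef
  have hQ : ∀ v, ∫ z, g (Function.update v i z) ∂D i = Q v := fun v => by
    exact integral_indicator_one (hslice v)
  have hQi : Integrable Q (Measure.pi D) :=
    (integrable_comp_update hgi i).integral_prod_left.congr (ae_of_all _ hQ)
  have hsp : serviceProb D A i = ∫ v, Q v ∂Measure.pi D := by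
    rw [serviceProb, ← integral_indicator_one (hA i), integral_eq_integral_update hgi i]
    exact integral_congr_ae (ae_of_all _ hQ)
  have hpay : ∀ v, ∫ z, truthfulPayment A (Function.update v i z) i ∂D i ≤ c + d * Q v := by
    intro v
    set T := sInf {z : ℝ | 0 ≤ z ∧ i ∈ A (Function.update v i z)} with hT
    have hTQ : ∫ z, truthfulPayment A (Function.update v i z) i ∂D i = Q v * T := by
      have : (fun z => truthfulPayment A (Function.update v i z) i)
          = {z | i ∈ A (Function.update v i z)}.indicator fun _ => T := by
        ext z
        simp only [truthfulPayment, Function.update_idem, indicator, mem_ofPred_eq, hT]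
      rw [this, integral_indicator_const _ (hslice v), smul_eq_mul]
    rw [hTQ]
    have hQ0 : 0 ≤ Q v := measureReal_nonneg
    have hQ1 : Q v ≤ 1 := measureReal_le_one
    rcases hQ0.eq_or_lt with h0 | h0
    · have := hmaj 0 (by simp)
      rw [revenueCurve_zero] at this
      rw [← h0, zero_mul]
      exact this
    · refine le_trans (mul_le_mul_of_nonneg_left ?_ hQ0) (hmaj (Q v) ⟨hQ0, hQ1⟩)
      refine le_priceAt (D i) (hmean i) h0 ?_
      have hae : ∀ᵐ x ∂D i, 0 ≤ x := by
        rw [ae_iff]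
        simpa [Iio] using hpos i
      refine ENNReal.toReal_mono (measure_ne_top _ _) (measure_mono_ae ?_)
      filter_upwards [hae] with z hz hzA
      exact csInf_le ⟨0, fun z hz => hz.1⟩ ⟨hz, hzA⟩
  rw [integral_eq_integral_update hint i, hsp]
  calc _ ≤ ∫ v, c + d * Q v ∂Measure.pi D :=
        integral_mono (integrable_comp_update hint i).integral_prod_left
          ((integrable_const c).add (hQi.const_mul d)) hpay
    _ = c + d * ∫ v, Q v ∂Measure.pi D := by
        rw [integral_add (integrable_const c) (hQi.const_mul d), integral_const_mul]
        simp

end truthful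

/-! ### Myerson's allocation rule is monotone -/

/-- Raising `w i` strictly raises the surplus of the old winner but leaves that of any set without
`i` unchanged, so no such set can win. Strictness requires the other summands to be finite. If `w i`
is not changed, the consistency of the tie-breaking is what counts. -/
theorem IsSurplusMaximizer.mem_update {n : ℕ} {J : Set (Finset (Fin n))}
    {t : (Fin n → EReal) → Finset (Fin n)} (ht : IsSurplusMaximizer J t) (hJ : ∅ ∈ J)
    {w : Fin n → EReal} (hw : ∀ j, w j ≠ ⊤) {i : Fin n} (hi : i ∈ t w) {x : EReal}
    (hx : w i ≤ x) : i ∈ t (Function.update w i x) := by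
  rcases hx.eq_or_lt with h | h
  · rwa [← h, Function.update_eq_self]
  by_contra hcon
  -- The empty set is feasible with surplus `0`, so a winning set has no member of value `-∞`.
  have hbot : ∀ j ∈ t w, w j ≠ ⊥ := by
    intro j hj hjb
    have h0 := (ht.1 w).2 ∅ hJ
    rw [Finset.sum_empty, ← Finset.add_sum_erase _ _ hj, hjb, EReal.bot_add] at h0
    exact absurd h0 (by simp)
  have hS : ∑ j ∈ t (Function.update w i x), Function.update w i x j
      = ∑ j ∈ t (Function.update w i x), w j :=
    Finset.sum_congr rfl fun j hj =>
      Function.update_of_ne (show j ≠ i by rintro rfl; exact hcon hj) _ _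
  have hT : ∑ j ∈ (t w).erase i, Function.update w i x j = ∑ j ∈ (t w).erase i, w j :=
    Finset.sum_congr rfl fun j hj => Function.update_of_ne (Finset.ne_of_mem_erase hj) _ _
  have hreal : ∃ r : ℝ, ∑ j ∈ (t w).erase i, w j = r := by
    refine Finset.sum_induction _ (fun y : EReal => ∃ r : ℝ, y = r) ?_ ⟨0, rfl⟩ ?_
    · rintro _ _ ⟨a, rfl⟩ ⟨b, rfl⟩
      exact ⟨a + b, (EReal.coe_add a b).symm⟩
    · exact fun j hj => ⟨_, (EReal.coe_toReal (hw j) (hbot j (Finset.mem_of_mem_erase hj))).symm⟩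
  obtain ⟨r, hr⟩ := hreal
  have h1 := (ht.1 (Function.update w i x)).2 (t w) (ht.1 w).1
  have h2 := (ht.1 w).2 _ (ht.1 (Function.update w i x)).1
  rw [hS] at h1
  have h3 := h1.trans h2
  rw [← Finset.add_sum_erase _ _ hi, ← Finset.add_sum_erase _ w hi, hT, hr,
    Function.update_self] at h3
  exact absurd h3 (not_le.2 (EReal.add_lt_add_right_coe h r))

section myerson

variable {n : ℕ} {J : Set (Finset (Fin n))} {ψ : Fin n → ℝ → EReal}
  {t : (Fin n → EReal) → Finset (Fin n)}

theorem myersonAlloc_mono (hJ : ∅ ∈ J) (ht : IsSurplusMaximizer J t)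
    (hψ : ∀ i, MonotoneOn (ψ i) (Ici 0)) (hψ' : ∀ i v, ψ i v ≠ ⊤) (v : Fin n → ℝ) (i : Fin n)
    (z z' : ℝ) (hz : 0 ≤ z) (hzz : z ≤ z')
    (h : i ∈ myersonAlloc ψ t (Function.update v i z)) :
    i ∈ myersonAlloc ψ t (Function.update v i z') := by
  have key : (fun j => ψ j (Function.update v i z' j))
      = Function.update (fun j => ψ j (Function.update v i z j)) i (ψ i z') := by
    ext j
    rcases eq_or_ne j i with rfl | hj
    · simp
    · simp [hj]
  unfold myersonAlloc at h ⊢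
  rw [key]
  refine ht.mem_update hJ (fun j => hψ' j _) h ?_
  rw [Function.update_self]
  exact hψ i hz (hz.trans hzz) hzz

theorem measurableSet_mem_myersonAlloc (ht : IsSurplusMaximizer J t)
    (hψ : ∀ i, Measurable (ψ i)) (i : Fin n) : MeasurableSet {v | i ∈ myersonAlloc ψ t v} := by
  have h : {v | i ∈ myersonAlloc ψ t v}
      = ⋃ S ∈ {S : Finset (Fin n) | i ∈ S}, (fun v j => ψ j (v j)) ⁻¹' {w | t w = S} := by
    ext v
    simp [myersonAlloc]
  rw [h]
  refine MeasurableSet.biUnion (Set.to_countable _) fun S _ => ?_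
  exact (measurable_pi_lambda _ fun j => (hψ j).comp (measurable_pi_apply j)) (ht.2 S)

end myerson

/-! ### Greedy processes -/

/-- A process that serves agents one by one: `avail x i` says that agent `i` can be served in state
`x`, and `mem x` is the set of agents served so far. At most `m` members of a feasible set become
unavailable per agent served. -/
structure GreedyProcess {n : ℕ} (J : Set (Finset (Fin n))) (m : ℕ) (X : Type*) where
  avail : X → Fin n → Prop
  upd : X → Fin n → X
  mem : X → Finset (Fin n)
  init : X
  inv : X → Prop
  mem_init : mem init = ∅
  mem_upd : ∀ x i, mem (upd x i) = insert i (mem x)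
  inv_init : inv init
  inv_upd : ∀ x i, inv x → avail x i → inv (upd x i)
  avail_of_upd : ∀ x i j, i ∉ mem x → avail (upd x i) j → avail x j
  card_le : ∀ x, inv x → ∀ T ∈ J, ∀ U ⊆ T, (∀ i ∈ U, ¬ avail x i) → U.card ≤ m * (mem x).card

namespace GreedyProcess

variable {n : ℕ} {J : Set (Finset (Fin n))} {m : ℕ} {X : Type*} (P : GreedyProcess J m X)
  (σ : Equiv.Perm (Fin n)) (acc acc' : Fin n → Prop)

open Classical in
/-- The state after the first `k` agents in the order `σ`, if `acc` are those who accept. -/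
def state (k : ℕ) : X :=
  ((List.finRange n).take k).foldl
    (fun x j => if P.avail x (σ j) ∧ acc (σ j) then P.upd x (σ j) else x) P.init

/-- Agent `σ k` can be served when its turn comes. -/
def IsOpen (k : Fin n) : Prop :=
  P.avail (P.state σ acc k) (σ k)

theorem state_zero : P.state σ acc 0 = P.init := by simp [state]

open Classical in
theorem state_succ (k : Fin n) : P.state σ acc (k + 1) =
    if P.IsOpen σ acc k ∧ acc (σ k) then P.upd (P.state σ acc k) (σ k) else P.state σ acc k := by
  have h : (k : ℕ) < (List.finRange n).length := by simp
  rw [state, List.take_succ_eq_append_getElem h, List.foldl_append]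
  simp only [List.getElem_finRange, List.foldl_cons, List.foldl_nil]
  rfl

variable {acc acc'} in
theorem state_congr {k : ℕ} (hk : k ≤ n) (h : ∀ j : Fin n, (j : ℕ) < k → (acc (σ j) ↔ acc' (σ j))) :
    P.state σ acc k = P.state σ acc' k := by
  classical
  induction k with
  | zero => simp [state_zero]
  | succ k ih =>
    have h1 := ih (by omega) fun j hj => h j (by omega)
    have e1 := P.state_succ σ acc ⟨k, hk⟩
    have e2 := P.state_succ σ acc' ⟨k, hk⟩
    have hO : P.IsOpen σ acc ⟨k, hk⟩ ↔ P.IsOpen σ acc' ⟨k, hk⟩ := by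
      rw [IsOpen, IsOpen]
      simp only [h1]
    exact e1.trans ((if_congr (and_congr hO (h ⟨k, hk⟩ (Nat.lt_succ_self k)))
      (congrArg (P.upd · _) h1) h1).trans e2.symm)

/-- Only agents before position `k` influence the state met there. This is the source of
independence between being open and accepting. -/
theorem isOpen_congr {k : Fin n} (h : ∀ i, i ≠ σ k → (acc i ↔ acc' i)) :
    P.IsOpen σ acc k ↔ P.IsOpen σ acc' k := by
  rw [IsOpen, IsOpen, P.state_congr σ k.2.le fun j hj => h _ fun hjk => ?_]
  rw [σ.injective hjk] at hj
  exact lt_irrefl _ hj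

theorem mem_state {k : ℕ} (hk : k ≤ n) (i : Fin n) : i ∈ P.mem (P.state σ acc k) ↔
    ∃ j : Fin n, (j : ℕ) < k ∧ σ j = i ∧ P.IsOpen σ acc j ∧ acc (σ j) := by
  classical
  induction k with
  | zero => simp [state_zero, P.mem_init]
  | succ k ih =>
    have ih := ih (by omega)
    have e := P.state_succ σ acc ⟨k, hk⟩
    simp only at e
    rw [e]
    split_ifs with hopen
    · rw [P.mem_upd, Finset.mem_insert, ih]
      constructor
      · rintro (rfl | ⟨j, hj, hj'⟩)
        · exact ⟨⟨k, hk⟩, Nat.lt_succ_self k, rfl, hopen⟩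
        · exact ⟨j, by omega, hj'⟩
      · rintro ⟨j, hj, rfl, hj'⟩
        rcases Nat.lt_succ_iff_lt_or_eq.1 hj with h | h
        · exact Or.inr ⟨j, h, rfl, hj'⟩
        · exact Or.inl (congrArg σ (Fin.ext h))
    · rw [ih]
      constructor
      · rintro ⟨j, hj, hj'⟩
        exact ⟨j, by omega, hj'⟩
      · rintro ⟨j, hj, rfl, hj'⟩
        rcases Nat.lt_succ_iff_lt_or_eq.1 hj with h | h
        · exact ⟨j, h, rfl, hj'⟩
        · obtain rfl : j = ⟨k, hk⟩ := Fin.ext h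
          exact absurd hj' hopen

theorem inv_state {k : ℕ} (hk : k ≤ n) : P.inv (P.state σ acc k) := by
  classical
  induction k with
  | zero => rw [state_zero]; exact P.inv_init
  | succ k ih =>
    have e := P.state_succ σ acc ⟨k, hk⟩
    simp only at e
    rw [e]
    split_ifs with hopen
    · exact P.inv_upd _ _ (ih (by omega)) hopen.1
    · exact ih (by omega)

/-- In contrapositive form: a blocked agent stays blocked. All agents blocked among the first `K`
are therefore unavailable in the single state `K`, where `card_le` applies. -/
theorem avail_state_of_le {j k : ℕ} (hjk : j ≤ k) (hk : k ≤ n) {i : Fin n}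
    (h : P.avail (P.state σ acc k) i) : P.avail (P.state σ acc j) i := by
  classical
  induction k, hjk using Nat.le_induction with
  | base => exact h
  | succ k hjk ih =>
    refine ih (by omega) ?_
    have e := P.state_succ σ acc ⟨k, hk⟩
    simp only at e
    rw [e] at h
    split_ifs at h with hopen
    · refine P.avail_of_upd _ _ _ (fun hmem => ?_) h
      obtain ⟨l, hl, hl', -⟩ := (P.mem_state σ acc (by omega) _).1 hmem
      rw [σ.injective hl'] at hl
      exact lt_irrefl _ hl
    · exact h

open Classical in
theorem sum_mem_state (f : Fin n → ℝ) {K : ℕ} (hK : K ≤ n) :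
    ∑ i ∈ P.mem (P.state σ acc K), f i
      = ∑ k ∈ Finset.univ.filter (fun k : Fin n => (k : ℕ) < K ∧ P.IsOpen σ acc k ∧ acc (σ k)), f (σ k) := by
  refine (Finset.sum_bij (fun k _ => σ k) ?_ (fun _ _ _ _ h => σ.injective h) ?_
    fun _ _ => rfl).symm
  · intro k hk
    rw [Finset.mem_filter] at hk
    exact (P.mem_state σ acc hK _).2 ⟨k, hk.2.1, rfl, hk.2.2⟩
  · intro i hi
    obtain ⟨k, hk, rfl, hk'⟩ := (P.mem_state σ acc hK _).1 hi
    exact ⟨k, by simp [hk, hk'], rfl⟩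

open Classical in
theorem card_blocked_le {T : Finset (Fin n)} (hT : T ∈ J) {K : ℕ} (hK : K ≤ n) :
    (Finset.univ.filter fun k : Fin n => (k : ℕ) < K ∧ ¬ P.IsOpen σ acc k ∧ σ k ∈ T).card
      ≤ m * (P.mem (P.state σ acc K)).card := by
  rw [← Finset.card_image_of_injective _ σ.injective]
  refine P.card_le _ (P.inv_state σ acc hK) T hT _ ?_ ?_
  · intro i hi
    obtain ⟨k, hk, rfl⟩ := Finset.mem_image.1 hi
    exact (Finset.mem_filter.1 hk).2.2.2
  · intro i hi
    obtain ⟨k, hk, rfl⟩ := Finset.mem_image.1 hi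
    have hk := (Finset.mem_filter.1 hk).2
    exact fun h => hk.2.1 (P.avail_state_of_le σ acc hk.1.le hK h)

end GreedyProcess

/-- Abel summation, by splitting off the smallest weight, which multiplies the full sum of `d`. -/
theorem sum_mul_nonneg_of_prefix {n : ℕ} (p d : Fin n → ℝ) (hp : Antitone p) (hp0 : ∀ k, 0 ≤ p k)
    (h : ∀ K ≤ n, 0 ≤ ∑ k : Fin n, if (k : ℕ) < K then d k else 0) : 0 ≤ ∑ k, p k * d k := by
  induction n with
  | zero => simp
  | succ n ih =>
    have h1 := ih (fun k => p k.castSucc - p (Fin.last n)) (fun k => d k.castSucc)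
      (fun a b hab => sub_le_sub_right (hp (by simpa using hab)) _)
      (fun k => sub_nonneg.2 (hp (Fin.le_last _))) (fun K hK => by
        have := h K (by omega)
        rw [Fin.sum_univ_castSucc] at this
        simpa [not_lt.2 hK] using this)
    have h2 := h (n + 1) le_rfl
    have h3 : ∀ k : Fin (n + 1), (k : ℕ) < n + 1 := fun k => k.2
    simp only [h3, if_true] at h2
    have h4 := mul_nonneg (hp0 (Fin.last n)) h2
    rw [Fin.sum_univ_castSucc] at h4 ⊢
    rw [mul_add, Finset.mul_sum] at h4
    simp only [sub_mul, Finset.sum_sub_distrib] at h1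
    linarith

/-! ### Charging the blocked agents to the served ones -/

namespace GreedyProcess

variable {n : ℕ} {J : Set (Finset (Fin n))} {m : ℕ} {X : Type*} (P : GreedyProcess J m X)
  (σ : Equiv.Perm (Fin n)) (acc : Fin n → Prop)

open Classical in
/-- For service probabilities `q` of a feasible random set, the blocked agents are worth at most
`m` times as much as those served. -/
theorem sum_blocked_le {Ω : Type*} [MeasurableSpace Ω] (μ : Measure Ω) [IsProbabilityMeasure μ]
    (A : Ω → Finset (Fin n)) (hAJ : ∀ ω, A ω ∈ J) (hA : ∀ i, MeasurableSet {ω | i ∈ A ω})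
    (q p : Fin n → ℝ) (hq : ∀ i, q i = μ.real {ω | i ∈ A ω}) (hp0 : ∀ i, 0 ≤ p i)
    (hp : Antitone fun k => p (σ k)) :
    ∑ k, p (σ k) * q (σ k) * (if P.IsOpen σ acc k then 0 else 1)
      ≤ m * ∑ k, p (σ k) * (if P.IsOpen σ acc k ∧ acc (σ k) then 1 else 0) := by
  have key := sum_mul_nonneg_of_prefix (fun k => p (σ k))
    (fun k => m * (if P.IsOpen σ acc k ∧ acc (σ k) then 1 else 0)
      - q (σ k) * (if P.IsOpen σ acc k then 0 else 1)) hp (fun k => hp0 _) ?_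
  · simp only [mul_sub, Finset.sum_sub_distrib, sub_nonneg] at key
    rw [Finset.mul_sum]
    calc _ = _ := Finset.sum_congr rfl fun k _ => by ring
      _ ≤ _ := key
      _ = _ := Finset.sum_congr rfl fun k _ => by ring
  intro K hK
  rw [← Finset.sum_filter, Finset.sum_sub_distrib, ← Finset.mul_sum, sub_nonneg]
  have hserved : ∑ k ∈ Finset.univ.filter (fun k : Fin n => (k : ℕ) < K),
      (if P.IsOpen σ acc k ∧ acc (σ k) then (1 : ℝ) else 0) = (P.mem (P.state σ acc K)).card := by
    have := P.sum_mem_state σ acc (fun _ => (1 : ℝ)) hK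
    rw [Finset.sum_const, nsmul_eq_mul, mul_one] at this
    rw [this, ← Finset.sum_filter, Finset.filter_filter]
  have hint : ∀ i, Integrable ({ω | i ∈ A ω}.indicator (1 : Ω → ℝ)) μ := fun i =>
    (integrable_const 1).indicator (hA i)
  -- The total service probability of the blocked agents is the expected number of them in the
  -- random feasible set `A ω`, which `card_blocked_le` bounds for each `ω`.
  have hblocked : ∑ k ∈ Finset.univ.filter (fun k : Fin n => (k : ℕ) < K), q (σ k) * (if P.IsOpen σ acc k then 0 else 1)
      = ∫ ω, ∑ k ∈ Finset.univ.filter (fun k : Fin n => (k : ℕ) < K ∧ ¬ P.IsOpen σ acc k),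
        {ω | σ k ∈ A ω}.indicator (1 : Ω → ℝ) ω ∂μ := by
    rw [integral_finsetSum _ fun k _ => hint (σ k), ← Finset.filter_filter, Finset.sum_filter
      (fun k => ¬ P.IsOpen σ acc k)]
    refine Finset.sum_congr rfl fun k _ => ?_
    rw [integral_indicator_one (hA _), ← hq]
    split_ifs <;> simp
  rw [hserved, hblocked]
  calc _ ≤ ∫ _, (m * (P.mem (P.state σ acc K)).card : ℝ) ∂μ := by
        refine integral_mono (integrable_finsetSum _ fun k _ => hint (σ k))
          (integrable_const _) fun ω => ?_
        have := P.card_blocked_le σ acc (hAJ ω) hK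
        simp only [indicator, mem_ofPred_eq, Pi.one_apply]
        rw [← Finset.sum_filter, Finset.filter_filter, Finset.sum_const, nsmul_eq_mul, mul_one]
        simp only [and_assoc]
        exact_mod_cast this
    _ = _ := by simp

end GreedyProcess

/-! ### Independent lotteries -/

/-- Independence under a product weight: draw a fresh copy of coordinate `i`, and swap it with the
old one. The swap is an involution that preserves the joint weight and the value of `U`. -/
theorem sum_prod_mul_of_forall_update {ι κ : Type*} [Fintype ι] [DecidableEq ι] [Fintype κ]
    (w : ι → κ → ℝ) (i : ι) (hw : ∑ l, w i l = 1) (U : (ι → κ) → ℝ)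
    (hU : ∀ c l, U (Function.update c i l) = U c) (H : κ → ℝ) :
    ∑ c, (∏ j, w j (c j)) * (U c * H (c i))
      = (∑ c, (∏ j, w j (c j)) * U c) * ∑ l, w i l * H l := by
  have hinv : Function.Involutive
      (fun p : (ι → κ) × κ => (Function.update p.1 i p.2, p.1 i)) := by
    rintro ⟨c, l⟩
    simp
  have hprod : ∀ (c : ι → κ) (l : κ), (∏ j, w j (Function.update c i l j)) * w i (c i)
      = (∏ j, w j (c j)) * w i l := by
    intro c l
    rw [← Finset.mul_prod_erase _ _ (Finset.mem_univ i),
      ← Finset.mul_prod_erase Finset.univ (fun j => w j (c j)) (Finset.mem_univ i)]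
    have : ∏ j ∈ Finset.univ.erase i, w j (Function.update c i l j)
        = ∏ j ∈ Finset.univ.erase i, w j (c j) :=
      Finset.prod_congr rfl fun j hj => by
        rw [Function.update_of_ne (Finset.ne_of_mem_erase hj)]
    rw [this, Function.update_self]
    ring
  calc ∑ c, (∏ j, w j (c j)) * (U c * H (c i))
      = ∑ c, ∑ l, (∏ j, w j (c j)) * (U c * H (c i)) * w i l := by
        refine Finset.sum_congr rfl fun c _ => ?_
        rw [← Finset.mul_sum, hw, mul_one]
    _ = ∑ p : (ι → κ) × κ, (∏ j, w j (p.1 j)) * (U p.1 * H (p.1 i)) * w i p.2 := by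
        rw [Fintype.sum_prod_type]
    _ = ∑ p : (ι → κ) × κ, (∏ j, w j (Function.update p.1 i p.2 j)) *
          (U (Function.update p.1 i p.2) * H (Function.update p.1 i p.2 i)) * w i (p.1 i) :=
        (Equiv.sum_comp hinv.toPerm
          fun p : (ι → κ) × κ => (∏ j, w j (p.1 j)) * (U p.1 * H (p.1 i)) * w i p.2).symm
    _ = ∑ p : (ι → κ) × κ, ((∏ j, w j (p.1 j)) * U p.1) * (w i p.2 * H p.2) := by
        refine Finset.sum_congr rfl fun p _ => ?_
        rw [hU, Function.update_self]
        linear_combination U p.1 * H p.2 * hprod p.1 p.2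
    _ = _ := by
        rw [Fintype.sum_prod_type, Finset.sum_mul]
        refine Finset.sum_congr rfl fun c _ => ?_
        rw [Finset.mul_sum]

section lotteries

variable {n : ℕ} (D : Fin n → Measure ℝ) (q : Fin n → ℝ)

/-- The set of agents who accept the offers `c` at the values `v`. -/
def acceptance (c : Fin n → Fin 3) (v : Fin n → ℝ) (i : Fin n) : Prop :=
  Accepts (offer (D i) (q i) (c i)) (v i)

/-- The expectation of a function of the offers and of the agents who accept them. -/
def lotteryExp (Φ : (Fin n → Fin 3) → (Fin n → Prop) → ℝ) : ℝ :=
  ∑ c : Fin n → Fin 3, (∏ i, offerProb (D i) (q i) (c i)) *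
    ∫ v, Φ c (acceptance D q c v) ∂(Measure.pi D)

theorem measurableSet_accepts (o : Option ℝ) : MeasurableSet {x | Accepts o x} := by
  cases o with
  | none => rw [setOf_accepts_none]; exact MeasurableSet.empty
  | some p => rw [setOf_accepts_some]; exact measurableSet_Ici

theorem measurable_acceptance (c : Fin n → Fin 3) : Measurable (acceptance D q c) :=
  measurable_pi_lambda _ fun i =>
    (measurableSet_setOfPred.1 (measurableSet_accepts (offer (D i) (q i) (c i)))).comp
      (measurable_pi_apply i)

theorem lotteryExp_const_mul (r : ℝ) (Φ : (Fin n → Fin 3) → (Fin n → Prop) → ℝ) :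
    lotteryExp D q (fun c a => r * Φ c a) = r * lotteryExp D q Φ := by
  rw [lotteryExp, lotteryExp, Finset.mul_sum]
  refine Finset.sum_congr rfl fun c _ => ?_
  rw [integral_const_mul]
  ring

variable [∀ i, IsProbabilityMeasure (D i)]

/-- There are only finitely many acceptance patterns, so an arbitrary `Φ` will do. -/
theorem integrable_comp_acceptance (c : Fin n → Fin 3) (Φ : (Fin n → Prop) → ℝ) :
    Integrable (fun v => Φ (acceptance D q c v)) (Measure.pi D) :=
  (Integrable.of_finite (μ := (Measure.pi D).map (acceptance D q c))
    (f := Φ)).comp_measurable (measurable_acceptance D q c)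

theorem lotteryExp_add (Φ Ψ : (Fin n → Fin 3) → (Fin n → Prop) → ℝ) :
    lotteryExp D q (fun c a => Φ c a + Ψ c a) = lotteryExp D q Φ + lotteryExp D q Ψ := by
  rw [lotteryExp, lotteryExp, lotteryExp, ← Finset.sum_add_distrib]
  refine Finset.sum_congr rfl fun c _ => ?_
  rw [← mul_add, ← integral_add (integrable_comp_acceptance D q c (Φ c))
    (integrable_comp_acceptance D q c (Ψ c))]

theorem lotteryExp_sum {κ : Type*} (s : Finset κ)
    (Φ : κ → (Fin n → Fin 3) → (Fin n → Prop) → ℝ) :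
    lotteryExp D q (fun c a => ∑ k ∈ s, Φ k c a) = ∑ k ∈ s, lotteryExp D q (Φ k) := by
  simp only [lotteryExp]
  rw [Finset.sum_comm]
  refine Finset.sum_congr rfl fun c _ => ?_
  rw [integral_finsetSum _ fun k _ => integrable_comp_acceptance D q c (Φ k c), Finset.mul_sum]

theorem lotteryExp_const (r : ℝ) : lotteryExp D q (fun _ _ => r) = r := by
  have h : ∏ i, ∑ k, offerProb (D i) (q i) k
      = ∑ c : Fin n → Fin 3, ∏ i, offerProb (D i) (q i) (c i) := Fintype.prod_sum _
  simp only [sum_offerProb, Finset.prod_const_one] at h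
  simp only [lotteryExp, integral_const, probReal_univ, one_smul]
  rw [← Finset.sum_mul, ← h, one_mul]

variable {D q}

theorem lotteryExp_mono (hpos : ∀ i, D i (Iio 0) = 0)
    (hmean : ∀ i, Integrable (fun x : ℝ => x) (D i)) (hq : ∀ i, q i ∈ Icc (0 : ℝ) 1)
    {Φ Ψ : (Fin n → Fin 3) → (Fin n → Prop) → ℝ} (h : ∀ c a, Φ c a ≤ Ψ c a) :
    lotteryExp D q Φ ≤ lotteryExp D q Ψ :=
  Finset.sum_le_sum fun c _ => mul_le_mul_of_nonneg_left
    (integral_mono (integrable_comp_acceptance D q c (Φ c))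
      (integrable_comp_acceptance D q c (Ψ c)) fun _ => h c _)
    (Finset.prod_nonneg fun i _ => offerProb_nonneg (hpos i) (hmean i) (hq i) _)

open Classical in
/-- Whether agent `i` accepts its offer is independent of an event that ignores the agent. -/
theorem lotteryExp_mul_accepts (i : Fin n) (G : (Fin n → Prop) → ℝ)
    (hG : ∀ a a' : Fin n → Prop, (∀ j, j ≠ i → (a j ↔ a' j)) → G a = G a') (h : Fin 3 → ℝ) :
    lotteryExp D q (fun c a => h (c i) * (G a * (if a i then 1 else 0)))
      = lotteryExp D q (fun _ a => G a) * ∑ l, offerProb (D i) (q i) l *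
        (h l * (D i).real {x | Accepts (offer (D i) (q i) l) x}) := by
  have hstep : ∀ c : Fin n → Fin 3, ∫ v, h (c i) * (G (acceptance D q c v) *
      (if acceptance D q c v i then 1 else 0)) ∂Measure.pi D
      = (∫ v, G (acceptance D q c v) ∂Measure.pi D) *
        (h (c i) * (D i).real {x | Accepts (offer (D i) (q i) (c i)) x}) := by
    intro c
    have h1 := integral_mul_eval_of_forall_update (μ := D) (i := i)
      (g := fun v => G (acceptance D q c v))
      (h := {x | Accepts (offer (D i) (q i) (c i)) x}.indicator 1)
      (integrable_comp_acceptance D q c fun a => G a * (if a i then 1 else 0))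
      (fun v z => hG _ _ fun j hj => by simp only [acceptance, Function.update_of_ne hj])
    rw [integral_indicator_one (measurableSet_accepts _)] at h1
    rw [integral_const_mul]
    have h2 : ∫ v, G (acceptance D q c v) * (if acceptance D q c v i then 1 else 0) ∂Measure.pi D
        = (∫ v, G (acceptance D q c v) ∂Measure.pi D)
          * (D i).real {x | Accepts (offer (D i) (q i) (c i)) x} := h1
    rw [h2]
    ring
  simp only [lotteryExp, hstep]
  exact sum_prod_mul_of_forall_update (fun j => offerProb (D j) (q j)) i (sum_offerProb _)
    (fun c => ∫ v, G (acceptance D q c v) ∂Measure.pi D)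
    (fun c l => integral_congr_ae (ae_of_all _ fun v => hG _ _ fun j hj => by
      simp only [acceptance, Function.update_of_ne hj]))
    (fun l => h l * (D i).real {x | Accepts (offer (D i) (q i) l) x})

/-- Sequential posted prices along a greedy process earn at least a `1 / (m + 1)` fraction of
`∑ pᵢ qᵢ`. -/
theorem GreedyProcess.sum_effectivePrice_mul_le {J : Set (Finset (Fin n))} {m : ℕ} {X : Type*}
    (P : GreedyProcess J m X) (σ : Equiv.Perm (Fin n))
    (hpos : ∀ i, D i (Iio 0) = 0) (hmean : ∀ i, Integrable (fun x : ℝ => x) (D i))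
    {A : (Fin n → ℝ) → Finset (Fin n)} (hAJ : ∀ v, A v ∈ J)
    (hA : ∀ i, MeasurableSet {v | i ∈ A v}) (hq : ∀ i, q i = serviceProb D A i)
    (hσ : Antitone fun k => effectivePrice (D (σ k)) (q (σ k))) :
    ∑ i, effectivePrice (D i) (q i) * q i ≤ (m + 1) * expectedSales D q
      (fun o v => P.mem (P.state σ (fun i => Accepts (o i) (v i)) n)) := by
  classical
  have hq01 : ∀ i, q i ∈ Icc (0 : ℝ) 1 := fun i => by
    rw [hq i]; exact ⟨measureReal_nonneg, measureReal_le_one⟩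
  set p : Fin n → ℝ := fun i => effectivePrice (D i) (q i) with hp
  set G : Fin n → (Fin n → Prop) → ℝ := fun k a => if P.IsOpen σ a k then 1 else 0 with hGdef
  have hG : ∀ k, ∀ a a' : Fin n → Prop, (∀ j, j ≠ σ k → (a j ↔ a' j)) → G k a = G k a' :=
    fun k a a' h => by simp only [hGdef, P.isOpen_congr σ a a' h]
  set O : Fin n → ℝ := fun k => lotteryExp D q fun _ a => G k a with hO
  have hsales : expectedSales D q
      (fun o v => P.mem (P.state σ (fun i => Accepts (o i) (v i)) n))
      = ∑ k, O k * (p (σ k) * q (σ k)) := by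
    have h1 : expectedSales D q
        (fun o v => P.mem (P.state σ (fun i => Accepts (o i) (v i)) n))
        = lotteryExp D q fun c a => ∑ k,
          (offer (D (σ k)) (q (σ k)) (c (σ k))).getD 0 * (G k a * (if a (σ k) then 1 else 0)) := by
      unfold expectedSales lotteryExp
      refine Finset.sum_congr rfl fun c _ => ?_
      congr 1
      refine integral_congr_ae (ae_of_all _ fun v => ?_)
      refine (P.sum_mem_state σ (acceptance D q c v)
        (fun i => (offer (D i) (q i) (c i)).getD 0) le_rfl).trans ?_
      rw [Finset.sum_filter]
      refine Finset.sum_congr rfl fun k _ => ?_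
      simp only [k.2, true_and, ite_and, hGdef]
      split_ifs <;> simp
    rw [h1, lotteryExp_sum]
    refine Finset.sum_congr rfl fun k _ => ?_
    rw [lotteryExp_mul_accepts (σ k) (G k) (hG k)
      (fun l => (offer (D (σ k)) (q (σ k)) l).getD 0),
      sum_offerProb_mul_price (hpos _) (hmean _) (hq01 _)]
  -- Charging a served agent its effective price instead of its actual offer leaves the expectation
  -- unchanged: both give `O k * (p (σ k) * q (σ k))`.
  have hserved : ∀ k, lotteryExp D q (fun _ a => G k a * (if a (σ k) then 1 else 0))
      = O k * q (σ k) := fun k => by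
    have := lotteryExp_mul_accepts (σ k) (G k) (hG k) (D := D) (q := q) (fun _ => 1)
    simp only [one_mul] at this
    rw [this, sum_offerProb_mul_accepts (hpos _) (hmean _) (hq01 _)]
  -- For each acceptance pattern the sum splits into open and blocked agents, and the blocked part
  -- is charged to the served ones.
  have hpoint : ∀ a : Fin n → Prop, ∑ i, p i * q i
      ≤ ∑ k, p (σ k) * q (σ k) * G k a
        + m * ∑ k, p (σ k) * (G k a * (if a (σ k) then 1 else 0)) := by
    intro a
    have h := P.sum_blocked_le σ a (Measure.pi D) A hAJ hA q p hq
      (fun i => effectivePrice_nonneg (hpos i) (hmean i) (hq01 i)) hσ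
    have e1 : ∑ i, p i * q i = ∑ k, p (σ k) * q (σ k) * G k a
        + ∑ k, p (σ k) * q (σ k) * (if P.IsOpen σ a k then 0 else 1) := by
      rw [← Equiv.sum_comp σ, ← Finset.sum_add_distrib]
      refine Finset.sum_congr rfl fun k _ => ?_
      simp only [hGdef]
      split_ifs <;> simp
    have e2 : ∑ k, p (σ k) * (if P.IsOpen σ a k ∧ a (σ k) then (1 : ℝ) else 0)
        = ∑ k, p (σ k) * (G k a * (if a (σ k) then 1 else 0)) := by
      refine Finset.sum_congr rfl fun k _ => ?_
      simp only [hGdef, ite_and]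
      split_ifs <;> simp
    rw [e1, ← e2]
    linarith
  calc ∑ i, p i * q i = lotteryExp D q (fun _ _ => ∑ i, p i * q i) :=
        (lotteryExp_const D q _).symm
    _ ≤ lotteryExp D q (fun _ a => ∑ k, p (σ k) * q (σ k) * G k a
        + m * ∑ k, p (σ k) * (G k a * (if a (σ k) then 1 else 0))) :=
        lotteryExp_mono hpos hmean hq01 fun _ a => hpoint a
    _ = ∑ k, p (σ k) * q (σ k) * O k + m * ∑ k, p (σ k) * (O k * q (σ k)) := by
        rw [lotteryExp_add, lotteryExp_const_mul, lotteryExp_sum, lotteryExp_sum]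
        simp only [lotteryExp_const_mul, hserved, hO]
    _ = _ := by
        rw [hsales, add_mul, one_mul, add_comm]
        congr 1
        · congr 1
          exact Finset.sum_congr rfl fun k _ => by ring
        · exact Finset.sum_congr rfl fun k _ => by ring

end lotteries

/-! ### Combinatorial auctions -/

/-- Double counting over the exhausted items: such an item `a` is used by at most `copies a` members
of `U` and by at least `copies a` members of `S`, while each member of `S` uses at most `m` items.
-/
theorem card_le_mul_card_of_exhausted {ι Item : Type*} [DecidableEq Item] {m : ℕ}
    (copies : Item → ℕ) (S U : Finset ι) (b c : ι → Finset Item) (hb : ∀ j ∈ S, (b j).card ≤ m)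
    (hc : ∀ a, (U.filter fun i => a ∈ c i).card ≤ copies a)
    (h : ∀ i ∈ U, ∃ a ∈ c i, copies a ≤ (S.filter fun j => a ∈ b j).card) :
    U.card ≤ m * S.card := by
  classical
  set E := (U.biUnion c).filter fun a => copies a ≤ (S.filter fun j => a ∈ b j).card with hE
  have hU : U ⊆ E.biUnion fun a => U.filter fun i => a ∈ c i := by
    intro i hi
    obtain ⟨a, ha, hle⟩ := h i hi
    simp only [hE, Finset.mem_biUnion, Finset.mem_filter]
    exact ⟨a, ⟨⟨i, hi, ha⟩, hle⟩, hi, ha⟩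
  calc U.card ≤ ∑ a ∈ E, (U.filter fun i => a ∈ c i).card :=
        (Finset.card_le_card hU).trans Finset.card_biUnion_le
    _ ≤ ∑ a ∈ E, (S.filter fun j => a ∈ b j).card :=
        Finset.sum_le_sum fun a ha => (hc a).trans (Finset.mem_filter.1 ha).2
    _ = ∑ j ∈ S, (E.filter fun a => a ∈ b j).card := by
        simp only [Finset.card_filter]
        exact Finset.sum_comm
    _ ≤ ∑ _j ∈ S, m := Finset.sum_le_sum fun j hj =>
        (Finset.card_le_card fun a ha => (Finset.mem_filter.1 ha).2).trans (hb j hj)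
    _ = m * S.card := by rw [Finset.sum_const, smul_eq_mul, mul_comm]

section auction

variable {n : ℕ} {Item : Type*} [DecidableEq Item] {m : ℕ} (copies : Item → ℕ)
  (desired : Fin n → Finset (Finset Item))

theorem empty_mem_bundleFeasible : ∅ ∈ bundleFeasible copies desired :=
  ⟨fun _ => ∅, by simp, by simp⟩

variable {copies desired}

theorem bundleFeasible_mono {S T : Finset (Fin n)} (hT : T ∈ bundleFeasible copies desired)
    (hST : S ⊆ T) : S ∈ bundleFeasible copies desired := by
  obtain ⟨b, hb, hc⟩ := hT
  exact ⟨b, fun i hi => hb i (hST hi), fun a =>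
    (Finset.card_le_card (Finset.filter_subset_filter _ hST)).trans (hc a)⟩

variable (copies desired)

/-- Serving every agent who fits. -/
def feasibleProcess (hm : ∀ i, ∀ b ∈ desired i, b.card ≤ m) :
    GreedyProcess (bundleFeasible copies desired) m (Finset (Fin n)) where
  avail A i := insert i A ∈ bundleFeasible copies desired
  upd A i := insert i A
  mem A := A
  init := ∅
  inv A := A ∈ bundleFeasible copies desired
  mem_init := rfl
  mem_upd _ _ := rfl
  inv_init := empty_mem_bundleFeasible copies desired
  inv_upd _ _ _ h := h
  avail_of_upd A i j _ h := bundleFeasible_mono h (Finset.insert_subset_insert j (Finset.subset_insert i A))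
  card_le := by
    rintro A ⟨b, hb, hbc⟩ T ⟨c, hc, hcc⟩ U hUT hU
    refine card_le_mul_card_of_exhausted copies A U b c (fun j hj => hm j _ (hb j hj))
      (fun a => (Finset.card_le_card (Finset.filter_subset_filter _ hUT)).trans (hcc a)) ?_
    intro i hi
    -- If every item of `c i` had a copy left, giving `c i` to `i` (in place of any bundle that `b`
    -- assigns to it) would make `insert i A` feasible.
    by_contra! hcon
    refine hU i hi ⟨Function.update b i (c i), fun j hj => ?_, fun a => ?_⟩
    · rcases eq_or_ne j i with rfl | hji
      · rw [Function.update_self]; exact hc j (hUT hi)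
      · rw [Function.update_of_ne hji]
        exact hb j ((Finset.mem_insert.1 hj).resolve_left hji)
    · by_cases ha : a ∈ c i
      · refine le_trans (Finset.card_le_card (t := insert i (A.filter fun j => a ∈ b j)) ?_)
          ((Finset.card_insert_le _ _).trans (hcon a ha))
        intro j hj
        rw [Finset.mem_filter, Finset.mem_insert] at hj
        rcases eq_or_ne j i with rfl | hji
        · exact Finset.mem_insert_self _ _
        · rw [Function.update_of_ne hji] at hj
          exact Finset.mem_insert_of_mem (Finset.mem_filter.2 ⟨hj.1.resolve_left hji, hj.2⟩)
      · refine le_trans (Finset.card_le_card ?_) (hbc a)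
        intro j hj
        rw [Finset.mem_filter, Finset.mem_insert] at hj
        rcases eq_or_ne j i with rfl | hji
        · rw [Function.update_self] at hj
          exact absurd hj.2 ha
        · rw [Function.update_of_ne hji] at hj
          exact Finset.mem_filter.2 ⟨hj.1.resolve_left hji, hj.2⟩

/-- Allocating an available bundle to every agent who has one. -/
def bundleProcess (hm : ∀ i, ∀ b ∈ desired i, b.card ≤ m)
    (β : (Fin n → Option (Finset Item)) → Fin n → Finset Item)
    (hβ : IsBundleRule copies desired β) :
    GreedyProcess (bundleFeasible copies desired) m (Fin n → Option (Finset Item)) where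
  avail x i := ∃ b, IsAvailable copies desired x i b
  upd x i := Function.update x i (some (β x i))
  mem x := Finset.univ.filter fun i => (x i).isSome
  init := fun _ => none
  inv x := ∀ j c, x j = some c → c.card ≤ m
  mem_init := by simp
  mem_upd x i := by
    ext j
    rcases eq_or_ne j i with rfl | hji
    · simp
    · simp [hji]
  inv_init := by simp
  inv_upd x i hx hav j c hj := by
    rcases eq_or_ne j i with rfl | hji
    · rw [Function.update_self, Option.some_inj] at hj
      rw [← hj]
      exact hm j _ (hβ x j hav).1
    · rw [Function.update_of_ne hji] at hj
      exact hx j c hj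
  avail_of_upd x i j hi := by
    rintro ⟨b, hb, hb'⟩
    refine ⟨b, hb, fun a ha => lt_of_le_of_lt (ncard_le_ncard ?_ (toFinite _)) (hb' a ha)⟩
    rintro k ⟨c, hk, hac⟩
    -- Agent `i` held no bundle before, so the update takes no holder of `a` away.
    have hki : k ≠ i := by
      rintro rfl
      simp [hk] at hi
    exact ⟨c, by rw [Function.update_of_ne hki]; exact hk, hac⟩
  card_le := by
    rintro x hx T ⟨c, hc, hcc⟩ U hUT hU
    refine card_le_mul_card_of_exhausted copies _ U (fun j => (x j).getD ∅) c (fun j hj => ?_)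
      (fun a => (Finset.card_le_card (Finset.filter_subset_filter _ hUT)).trans (hcc a)) ?_
    · obtain ⟨b, hb⟩ := Option.isSome_iff_exists.1 (Finset.mem_filter.1 hj).2
      rw [hb]
      exact hx j b hb
    · intro i hi
      by_contra! hcon
      refine hU i hi ⟨c i, hc i (hUT hi), fun a ha => lt_of_eq_of_lt ?_ (hcon a ha)⟩
      rw [← ncard_coe_finset]
      congr 1
      ext j
      rcases h : x j with _ | b <;> simp [h]

variable {copies desired}

theorem spmServed_eq (hm : ∀ i, ∀ b ∈ desired i, b.card ≤ m) (σ : Equiv.Perm (Fin n)) :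
    spmServed (bundleFeasible copies desired) σ = fun o v => (feasibleProcess copies desired hm).mem
      ((feasibleProcess copies desired hm).state σ (fun i => Accepts (o i) (v i)) n) := by
  funext o v
  rw [GreedyProcess.state, List.take_of_length_le (by simp)]
  rfl

theorem bundleServed_eq (hm : ∀ i, ∀ b ∈ desired i, b.card ≤ m)
    (β : (Fin n → Option (Finset Item)) → Fin n → Finset Item)
    (hβ : IsBundleRule copies desired β) (σ : Equiv.Perm (Fin n)) :
    bundleServed copies desired β σ = fun o v => (bundleProcess copies desired hm β hβ).mem
      ((bundleProcess copies desired hm β hβ).state σ (fun i => Accepts (o i) (v i)) n) := by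
  funext o v
  rw [GreedyProcess.state, List.take_of_length_le (by simp)]
  rfl

end auction
theorem mainTheorem8 {n : ℕ} {Item : Type*} [DecidableEq Item] (m : ℕ)
    -- the auction: copies of each item, desired bundles of each agent, of size at most `m`
    (copies : Item → ℕ) (desired : Fin n → Finset (Finset Item))
    (hm : ∀ i, ∀ b ∈ desired i, b.card ≤ m)
    -- independent nonnegative values of finite mean
    (D : Fin n → Measure ℝ) (hD : ∀ i, IsProbabilityMeasure (D i))
    (hpos : ∀ i, D i (Iio 0) = 0) (hmean : ∀ i, Integrable (fun x : ℝ => x) (D i))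
    -- Myerson's mechanism
    (ψ : Fin n → ℝ → EReal) (hψ : ∀ i, IsMyersonValue (D i) (ψ i))
    (t : (Fin n → EReal) → Finset (Fin n))
    (ht : IsSurplusMaximizer (bundleFeasible copies desired) t)
    -- the probabilities with which it serves the agents
    (q : Fin n → ℝ) (hq : ∀ i, q i = serviceProb D (myersonAlloc ψ t) i)
    -- an order of the agents by decreasing price
    (σ : Equiv.Perm (Fin n)) (hσ : Antitone fun k => effectivePrice (D (σ k)) (q (σ k))) :
    Integrable (fun v => ∑ i, truthfulPayment (myersonAlloc ψ t) v i) (Measure.pi D) ∧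
    truthfulRevenue D (myersonAlloc ψ t) ≤
      (m + 1) * expectedSales D q (spmServed (bundleFeasible copies desired) σ) ∧
    ∀ β : (Fin n → Option (Finset Item)) → Fin n → Finset Item, IsBundleRule copies desired β →
      truthfulRevenue D (myersonAlloc ψ t) ≤
        (m + 1) * expectedSales D q (bundleServed copies desired β σ) := by

  have hψ' := fun i => (hψ i).properties (hpos i) (hmean i)
  have hJ := empty_mem_bundleFeasible copies desired
  have hA := measurableSet_mem_myersonAlloc ht fun i => (hψ' i).1
  have hAJ : ∀ v, myersonAlloc ψ t v ∈ bundleFeasible copies desired := fun v => (ht.1 _).1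
  have hint := integrable_truthfulPayment hpos hmean hA
    (myersonAlloc_mono hJ ht (fun i => (hψ' i).2.1) fun i => (hψ' i).2.2)
  have hrev : truthfulRevenue D (myersonAlloc ψ t) ≤ ∑ i, effectivePrice (D i) (q i) * q i := by
    rw [truthfulRevenue, integral_finsetSum _ fun i _ => hint i]
    refine Finset.sum_le_sum fun i _ =>
      (integral_truthfulPayment_le hpos hmean hA i (hint i)).trans ?_
    rw [← hq i]
    refine ironedCurve_le_effectivePrice_mul (hpos i) (hmean i) ?_
    rw [hq i]
    exact ⟨measureReal_nonneg, measureReal_le_one⟩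
  refine ⟨integrable_finsetSum _ fun i _ => hint i, hrev.trans ?_, fun β hβ => hrev.trans ?_⟩
  · rw [spmServed_eq hm]
    exact (feasibleProcess copies desired hm).sum_effectivePrice_mul_le σ hpos hmean hAJ hA hq hσ
  · rw [bundleServed_eq hm β hβ]
    exact (bundleProcess copies desired hm β hβ).sum_effectivePrice_mul_le σ hpos hmean hAJ hA hq hσ

end
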